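/- Let $G$ be a (Hausdorff) locally compact non-compact group with a left Haar measure, and let $\kappa(G)$ be its compact covering number, i.e. the least cardinality of a covering of $G$ by compact sets. Let $w : G \to (0,\infty)$ be a weight, i.e. a continuous function with $w(st) \le w(s)w(t)$ for all $s,t \in G$ and $w(e)=1$. Put $$L_1(G,w)=\{f : wf \in L_1(G)\},\quad L_\infty(G,w^{-1})=\{h : w^{-1}h \in L_\infty(G)\}=L_1(G,w)^*,\quad \mathrm{LUC}(G,w^{-1})=\{f : w^{-1}f \in \mathrm{LUC}(G)\},$$ with the norms for which multiplication, respectively division, by $w$ is an isometry onto the unweighted space. Here all functions are complex-valued, $L_\infty(G)$ consists of the locally measurable functions that are bounded outside a locally null set, modulo locally null functions, and $\mathrm{LUC}(G)$ consists of the bounded continuous functions $f$ for which $y \mapsto f(y\,\cdot)$ is continuous for the supremum norm. For $h \in L_\infty(G,w^{-1})$, $g \in L_1(G,w)$ and $m \in \mathrm{LUC}(G,w^{-1})^*$ define $h \odot g \in \mathrm{LUC}(G,w^{-1})$ and $m \diamond h \in L_\infty(G,w^{-1})$ by $$\langle h \odot g, f\rangle = \langle h, g * f\rangle \quad (f \in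 L_1(G,w)), \qquad \langle m \diamond h, g\rangle = \langle m, h \odot g\rangle \quad (g \in L_1(G,w)).$$ For $y \in G$ let $\widetilde{\delta}_y = w(y)^{-1}\delta_y \in \mathrm{Ball}(\mathrm{LUC}(G,w^{-1})^*)$ be the normalized point mass, and let $\widetilde{\delta}_G = \{\widetilde{\delta}_y : y \in G\}$. Suppose that there is a set $S \subseteq G$ such that $S$ is dispersed, i.e. not contained in the union of any family of fewer than $\kappa(G)$ compact subsets of $G$, and $w$ is diagonally bounded on $S$, i.e. $\sup_{s \in S} w(s)w(s^{-1}) < \infty$. Then there exists a family $(\psi_\alpha)_{\alpha \in I}$, $|I| = \kappa(G)$, of functionals in $\overline{\widetilde{\delta}_G}^{\,w^*} \subseteq \mathrm{Ball}(\mathrm{LUC}(G,w^{-1})^*)$ such that for every bounded family $(h_\alpha)_{\alpha \in I}$ in $L_\infty(G,w^{-1})$ there exists a single function $h \in L_\infty(G,w^{-1})$ with $h_\alpha = \psi_\alpha \diamond h$ for all $\alpha \in I$. -/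

import Mathlib

open MeasureTheory Topology Filter

universe u

namespace WeightedGroup

noncomputable section

/-- A weight on a topological group: a positive continuous submultiplicative function which takes
the value `1` at the neutral element. -/
structure Weight (G : Type u) [Group G] [TopologicalSpace G] where
  toFun : G → ℝ
  continuous' : Continuous toFun
  pos' : ∀ x, 0 < toFun x
  mul_le' : ∀ s t, toFun (s * t) ≤ toFun s * toFun t
  one' : toFun 1 = 1

instance (G : Type u) [Group G] [TopologicalSpace G] : CoeFun (Weight G) (fun _ => G → ℝ) :=
  ⟨Weight.toFun⟩

/-- The compact covering number: the least cardinality of a covering by compact sets. -/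
def compactCoveringNumber (G : Type u) [TopologicalSpace G] : Cardinal.{u} :=
  sInf {c | ∃ 𝒦 : Set (Set G), (∀ K ∈ 𝒦, IsCompact K) ∧ ⋃₀ 𝒦 = Set.univ ∧ Cardinal.mk 𝒦 = c}

/-- A set is dispersed if it is not contained in the union of fewer compact sets than the
compact covering number. -/
def IsDispersed {G : Type u} [TopologicalSpace G] (S : Set G) : Prop :=
  ∀ 𝒦 : Set (Set G), (∀ K ∈ 𝒦, IsCompact K) → Cardinal.mk 𝒦 < compactCoveringNumber G →
    ¬ S ⊆ ⋃₀ 𝒦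

section Weighted

variable {G : Type u} [Group G] [TopologicalSpace G]

/-- The weight is diagonally bounded on `S`: the supremum of `w s * w s⁻¹` over `S` is finite. -/
def Weight.DiagonallyBoundedOn (w : Weight G) (S : Set G) : Prop :=
  BddAbove ((fun s => w s * w s⁻¹) '' S)

/-- `f` belongs to `LUC(G)`: it is bounded, continuous, and `y ↦ (x ↦ f (y * x))` is continuous
for the supremum norm (continuity at `1` gives continuity everywhere). -/
structure IsLUC (f : G → ℂ) : Prop where
  continuous : Continuous f
  bounded : ∃ C : ℝ, ∀ x, ‖f x‖ ≤ C
  uniform : ∀ ε : ℝ, 0 < ε → ∀ᶠ y in 𝓝 (1 : G), ∀ x, ‖f (y * x) - f x‖ ≤ ε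

theorem IsLUC.add {f g : G → ℂ} (hf : IsLUC f) (hg : IsLUC g) : IsLUC (f + g) := by
  obtain ⟨C, hC⟩ := hf.bounded
  obtain ⟨D, hD⟩ := hg.bounded
  refine ⟨hf.continuous.add hg.continuous,
    ⟨C + D, fun x => (norm_add_le _ _).trans (add_le_add (hC x) (hD x))⟩, fun ε hε => ?_⟩
  filter_upwards [hf.uniform (ε / 2) (half_pos hε), hg.uniform (ε / 2) (half_pos hε)]
    with y h1 h2 x
  have h3 : (f + g) (y * x) - (f + g) x = (f (y * x) - f x) + (g (y * x) - g x) := by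
    simp only [Pi.add_apply]; ring
  rw [h3]
  linarith [norm_add_le (f (y * x) - f x) (g (y * x) - g x), h1 x, h2 x]

theorem IsLUC.smul {f : G → ℂ} (c : ℂ) (hf : IsLUC f) : IsLUC (c • f) := by
  obtain ⟨C, hC⟩ := hf.bounded
  refine ⟨hf.continuous.const_smul c, ⟨‖c‖ * C, fun x => ?_⟩, fun ε hε => ?_⟩
  · rw [Pi.smul_apply, norm_smul]
    exact mul_le_mul_of_nonneg_left (hC x) (norm_nonneg c)
  · have hc : 0 < ‖c‖ + 1 := by positivity
    filter_upwards [hf.uniform (ε / (‖c‖ + 1)) (div_pos hε hc)] with y h1 x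
    rw [Pi.smul_apply, Pi.smul_apply, ← smul_sub, norm_smul]
    calc ‖c‖ * ‖f (y * x) - f x‖ ≤ (‖c‖ + 1) * (ε / (‖c‖ + 1)) :=
          mul_le_mul (by linarith) (h1 x) (norm_nonneg _) hc.le
      _ = ε := mul_div_cancel₀ ε hc.ne'

theorem IsLUC.zero : IsLUC (0 : G → ℂ) :=
  ⟨continuous_const, ⟨0, fun x => by simp⟩, fun ε hε => by simp [hε.le]⟩

/-- The functions `f` such that `w⁻¹ f` belongs to `LUC(G)`. -/
def lucSubmodule (w : Weight G) : Submodule ℂ (G → ℂ) where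
  carrier := {f | IsLUC (fun x => ((w x)⁻¹ : ℂ) * f x)}
  zero_mem' := by
    have h : (fun x => ((w x)⁻¹ : ℂ) * (0 : G → ℂ) x) = 0 := by ext x; simp
    change IsLUC _; rw [h]
    exact IsLUC.zero
  add_mem' := by
    intro f g hf hg
    have h : (fun x => ((w x)⁻¹ : ℂ) * (f + g) x)
        = (fun x => ((w x)⁻¹ : ℂ) * f x) + (fun x => ((w x)⁻¹ : ℂ) * g x) := by
      ext x; simp [mul_add]
    change IsLUC _; rw [h]
    exact IsLUC.add hf hg
  smul_mem' := by
    intro c f hf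
    have h : (fun x => ((w x)⁻¹ : ℂ) * (c • f) x) = c • (fun x => ((w x)⁻¹ : ℂ) * f x) := by
      ext x; simp [mul_left_comm]
    change IsLUC _; rw [h]
    exact IsLUC.smul c hf

/-- The space `LUC(G, w⁻¹)`. It is a type of its own, so that it carries the weighted supremum
norm below and not the topology of pointwise convergence. -/
def LUCw (w : Weight G) : Type u := lucSubmodule w

instance (w : Weight G) : AddCommGroup (LUCw w) :=
  inferInstanceAs (AddCommGroup (lucSubmodule w))

instance (w : Weight G) : Module ℂ (LUCw w) :=
  inferInstanceAs (Module ℂ (lucSubmodule w))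

/-- The underlying function of an element of `LUC(G, w⁻¹)`. -/
def LUCw.val {w : Weight G} (f : LUCw w) : G → ℂ := Subtype.val f

theorem LUCw.isLUC {w : Weight G} (f : LUCw w) : IsLUC (fun x => ((w x)⁻¹ : ℂ) * f.val x) :=
  Subtype.property f

/-- Division by the weight, from `LUC(G, w⁻¹)` to the bounded continuous functions. -/
def LUCw.divWeight (w : Weight G) : LUCw w →ₗ[ℂ] BoundedContinuousFunction G ℂ where
  toFun f := BoundedContinuousFunction.ofNormedAddCommGroup (fun x => ((w x)⁻¹ : ℂ) * f.val x)
    f.isLUC.continuous f.isLUC.bounded.choose f.isLUC.bounded.choose_spec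
  map_add' f g := by
    ext x
    exact mul_add _ _ _
  map_smul' c f := by
    ext x
    exact mul_left_comm _ _ _

theorem LUCw.divWeight_apply {w : Weight G} (f : LUCw w) (x : G) :
    LUCw.divWeight w f x = ((w x)⁻¹ : ℂ) * f.val x := rfl

theorem LUCw.divWeight_injective (w : Weight G) : Function.Injective (LUCw.divWeight w) := by
  intro f g hfg
  apply Subtype.ext
  funext x
  have h := DFunLike.congr_fun hfg x
  rw [LUCw.divWeight_apply, LUCw.divWeight_apply] at h
  exact mul_left_cancel₀ (inv_ne_zero (Complex.ofReal_ne_zero.mpr (w.pos' x).ne')) h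

/-- The norm of `LUC(G, w⁻¹)` is the supremum norm of `w⁻¹ f`. -/
instance (w : Weight G) : NormedAddCommGroup (LUCw w) :=
  NormedAddCommGroup.induced (LUCw w) (BoundedContinuousFunction G ℂ) (LUCw.divWeight w)
    (LUCw.divWeight_injective w)

instance (w : Weight G) : NormedSpace ℂ (LUCw w) :=
  NormedSpace.induced ℂ (LUCw w) (BoundedContinuousFunction G ℂ) (LUCw.divWeight w)

/-- The normalized point mass `w(y)⁻¹ δ_y`, as a functional on `LUC(G, w⁻¹)`. -/
def pointMass (w : Weight G) (y : G) : WeakDual ℂ (LUCw w) :=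
  StrongDual.toWeakDual
    (LinearMap.mkContinuous
      { toFun := fun f => ((w y)⁻¹ : ℂ) * f.val y
        map_add' := fun _ _ => mul_add _ _ _
        map_smul' := fun _ _ => mul_left_comm _ _ _ } 1
      (fun f => by
        rw [one_mul]
        exact (LUCw.divWeight w f).norm_coe_le_norm y))

theorem pointMass_apply (w : Weight G) (y : G) (f : LUCw w) :
    pointMass w y f = ((w y)⁻¹ : ℂ) * f.val y := rfl

variable [MeasurableSpace G]

/-- `f` belongs to `L₁(G, w)`: the function `w f` is integrable. -/
def MemL1 (μ : Measure G) (w : Weight G) (f : G → ℂ) : Prop :=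
  Integrable (fun x => (w x : ℂ) * f x) μ

/-- `h` is locally measurable and `|w⁻¹ h| ≤ C` locally almost everywhere. "Locally" means on
every compact set; this is the reading under which `L_∞` is the dual of `L₁` also when the group
is not `σ`-compact. -/
def LinfBound (μ : Measure G) (w : Weight G) (C : ℝ) (h : G → ℂ) : Prop :=
  ∀ K : Set G, IsCompact K →
    AEStronglyMeasurable h (μ.restrict K) ∧ ∀ᵐ x ∂(μ.restrict K), (w x)⁻¹ * ‖h x‖ ≤ C

/-- `h` (a representative of a class modulo locally null functions) belongs to
`L_∞(G, w⁻¹)`. -/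
def MemLinf (μ : Measure G) (w : Weight G) (h : G → ℂ) : Prop :=
  ∃ C : ℝ, LinfBound μ w C h

/-- A norm-bounded family in `L_∞(G, w⁻¹)`. -/
def BoundedFamily (μ : Measure G) (w : Weight G) {I : Type u} (h : I → G → ℂ) : Prop :=
  ∃ C : ℝ, ∀ α, LinfBound μ w C (h α)

/-- The duality `⟨h, f⟩` between `L_∞(G, w⁻¹)` and `L₁(G, w)`. -/
def pairing (μ : Measure G) (h f : G → ℂ) : ℂ := ∫ x, h x * f x ∂μ

/-- The convolution product `g * f` of `L₁(G, w)`. -/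
def conv (μ : Measure G) (g f : G → ℂ) : G → ℂ := fun x => ∫ t, g t * f (t⁻¹ * x) ∂μ

/-- `φ = h ⊙ g`, where `⟨h ⊙ g, f⟩ = ⟨h, g * f⟩` for all `f ∈ L₁(G, w)`. -/
def IsOdot (μ : Measure G) (w : Weight G) (φ h g : G → ℂ) : Prop :=
  ∀ f : G → ℂ, MemL1 μ w f → pairing μ φ f = pairing μ h (conv μ g f)

/-- `k = m ⋄ h`, where `⟨m ⋄ h, g⟩ = ⟨m, h ⊙ g⟩` for all `g ∈ L₁(G, w)`. That `h ⊙ g` is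
(represented by) an element of `LUC(G, w⁻¹)`, which is then unique, is part of what is
asserted. -/
def IsDiamond (μ : Measure G) (w : Weight G) (k : G → ℂ) (m : WeakDual ℂ (LUCw w))
    (h : G → ℂ) : Prop :=
  ∀ g : G → ℂ, MemL1 μ w g →
    ∃ φ : LUCw w, IsOdot μ w φ.val h g ∧ pairing μ k g = m φ

end Weighted

end

end WeightedGroup

set_option linter.unusedSectionVars false

/-! The product `h ⊙ g` is the function `x ↦ ∫ h(tx) g(t) dt`, so the normalized point mass at `y`
sends it to `∫ w(y)⁻¹ h(ty) g(t) dt`. This is close to `⟨h_α, g⟩` as soon as `h(ty) = w(y) h_α(t)`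
for all `t` in a large compact set.

Impose this for every `α` and every member `E_F` of a cofinal family of `κ(G)` compact sets, at a
point `y = y_(F,α)` of `S`. There are only `κ(G)` pairs `(F, α)`, since `κ(G)` is infinite.
Transfinite recursion in the dispersed set `S` therefore makes the translates `E_F y_(F,α)`
uniformly separated (`IsDispersed.exists_disjoint`), so one function `h` meets all the requirements.
On a translate, `|h(s)| ≤ w(y) C w(sy⁻¹) ≤ C w(y) w(y⁻¹) w(s)`, and diagonal boundedness on `S`
keeps `h` in `L_∞(G, w⁻¹)`. The functional `ψ_α` is a weak* limit of the point masses at `y_(F,α)`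
along an ultrafilter in `F`, chosen before the `h_α` are given; `tendsto_pointMass_odotLUC`
identifies its value.

It remains to show that the integral formula represents `h ⊙ g` and lies in `LUC(G, w⁻¹)`
(`isOdot_odot`, `odot_uniform`, `isLUC_of_uniform`). As `G` need not be σ-compact and `h` is only
locally measurable, Fubini is first used for continuous compactly supported `g`, `f`; the general
case expands both into absolutely convergent series of such functions. -/

namespace WeightedGroup

open Measure Pointwise
open scoped NNReal ENNReal

/-! ### Modular function, right translation and inversion of Haar measure. -/

section Haar
variable {G : Type u} [Group G] [TopologicalSpace G] [IsTopologicalGroup G] [T2Space G]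
  [LocallyCompactSpace G] [MeasurableSpace G] [BorelSpace G]

theorem map_mul_right_eq (μ : Measure G) [μ.IsHaarMeasure] [μ.Regular] (a : G) :
    μ.map (· * a) = modularCharacterFun a • μ := by
  have : (μ.map (· * a)).Regular := Regular.map (Homeomorph.mulRight a)
  rw [modularCharacterFun_eq_haarScalarFactor μ a]
  exact isMulLeftInvariant_eq_smul_of_regular _ μ

theorem integral_comp_mul_right {E : Type*} [NormedAddCommGroup E] [NormedSpace ℝ E]
    (μ : Measure G) [μ.IsHaarMeasure] [μ.Regular] (f : G → E) (a : G) :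
    ∫ t, f (t * a) ∂μ = (modularCharacterFun a : ℝ) • ∫ t, f t ∂μ := by
  have h := integral_map_equiv (μ := μ) (MeasurableEquiv.mulRight a) f
  simp only [MeasurableEquiv.coe_mulRight] at h
  rw [← h, map_mul_right_eq, integral_smul_nnreal_measure]
  rfl

theorem integral_inv_measure {E : Type*} [NormedAddCommGroup E] [NormedSpace ℝ E]
    (μ : Measure G) (f : G → E) : ∫ y, f y ∂μ.inv = ∫ y, f y⁻¹ ∂μ :=
  integral_map_equiv (MeasurableEquiv.inv G) f

/-- For a fixed bump `g`, the value `Δ(a)` is the quotient of `∫ g(ta) dt` by `∫ g`, and the former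
depends continuously on `a`. -/
theorem continuous_modularCharacterFun (μ : Measure G) [μ.IsHaarMeasure] [μ.Regular] :
    Continuous fun a : G => (modularCharacterFun a : ℝ) := by
  obtain ⟨⟨g, g_cont⟩, g_comp, g_nonneg, g_one⟩ :
    ∃ (g : C(G, ℝ)), HasCompactSupport g ∧ 0 ≤ g ∧ g 1 ≠ 0 := exists_continuous_nonneg_pos 1
  have hpos : 0 < ∫ x, g x ∂μ :=
    g_cont.integral_pos_of_hasCompactSupport_nonneg_nonzero g_comp g_nonneg g_one
  have h := (continuous_integral_apply_inv_mul (μ := μ.inv) g_cont g_comp).div_const (∫ x, g x ∂μ)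
  convert h using 2 with a
  simp only [integral_inv_measure, inv_inv]
  rw [integral_comp_mul_right, smul_eq_mul, mul_div_cancel_right₀ _ hpos.ne']

theorem modularCharacterFun_inv (a : G) :
    (modularCharacterFun a⁻¹ : ℝ) = (modularCharacterFun a : ℝ)⁻¹ := by
  have h : modularCharacterFun a⁻¹ * modularCharacterFun a = 1 := by
    rw [← modularCharacterFun_map_mul, inv_mul_cancel, modularCharacterFun_map_one]
  exact eq_inv_of_mul_eq_one_left (by exact_mod_cast h)

/-- Comparison of the left invariant `μ` with the right invariant `μ.inv`: the density between them
is computed by testing on translates of one bump `g`, and it is `Δ`. -/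
theorem integral_inv_mul_modularCharacterFun_real (μ : Measure G) [μ.IsHaarMeasure] [μ.Regular]
    {f : G → ℝ} (hf : Continuous f) (h'f : HasCompactSupport f) :
    ∫ x, f x ∂μ = ∫ x, (modularCharacterFun x : ℝ) * f x⁻¹ ∂μ := by
  obtain ⟨⟨g, g_cont⟩, g_comp, g_nonneg, g_one⟩ :
    ∃ (g : C(G, ℝ)), HasCompactSupport g ∧ 0 ≤ g ∧ g 1 ≠ 0 := exists_continuous_nonneg_pos 1
  have hpos : 0 < ∫ x, g x ∂μ :=
    g_cont.integral_pos_of_hasCompactSupport_nonneg_nonzero g_comp g_nonneg g_one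
  have h := integral_isMulLeftInvariant_isMulRightInvariant_combo (μ := μ) (ν := μ.inv)
    hf h'f g_cont g_comp g_nonneg g_one
  have hD : ∀ y, ∫ z, g (z⁻¹ * y) ∂μ.inv = (modularCharacterFun y : ℝ) * ∫ x, g x ∂μ := by
    intro y
    simp only [integral_inv_measure, inv_inv]
    rw [integral_comp_mul_right, smul_eq_mul]
  change ∫ x, f x ∂μ = (∫ y, f y * (∫ z, g (z⁻¹ * y) ∂μ.inv)⁻¹ ∂μ.inv) * ∫ x, g x ∂μ at h
  simp only [hD] at h
  rw [h, ← integral_mul_const, integral_inv_measure]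
  congr with y
  simp only [modularCharacterFun_inv]
  have : (modularCharacterFun y : ℝ) ≠ 0 := by
    exact_mod_cast (modularCharacterFun_pos y).ne'
  field_simp

theorem hasCompactSupport_comp_inv {E : Type*} [Zero E] {f : G → E} (h'f : HasCompactSupport f) :
    HasCompactSupport fun x => f x⁻¹ :=
  h'f.comp_homeomorph (Homeomorph.inv G)

theorem integral_inv_mul_modularCharacterFun (μ : Measure G) [μ.IsHaarMeasure] [μ.Regular]
    {f : G → ℂ} (hf : Continuous f) (h'f : HasCompactSupport f) :
    ∫ x, f x ∂μ = ∫ x, ((modularCharacterFun x : ℝ) : ℂ) * f x⁻¹ ∂μ := by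
  have hc := continuous_modularCharacterFun μ
  have hi : Integrable (fun x => ((modularCharacterFun x : ℝ) : ℂ) * f x⁻¹) μ := by
    apply Continuous.integrable_of_hasCompactSupport
    · fun_prop
    · exact (hasCompactSupport_comp_inv h'f).mul_left
  rw [← integral_re_add_im (hf.integrable_of_hasCompactSupport h'f), ← integral_re_add_im hi]
  have h1 := integral_inv_mul_modularCharacterFun_real μ (f := fun x => (f x).re)
    (by fun_prop) (h'f.comp_left (g := Complex.re) rfl)
  have h2 := integral_inv_mul_modularCharacterFun_real μ (f := fun x => (f x).im)
    (by fun_prop) (h'f.comp_left (g := Complex.im) rfl)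
  simp only [RCLike.re_to_complex, RCLike.im_to_complex, Complex.re_ofReal_mul,
    Complex.im_ofReal_mul, h1, h2]

/-- Inversion maps null sets to locally null sets. -/
theorem measure_inter_inv_eq_zero (μ : Measure G) [μ.IsHaarMeasure] [μ.Regular] {N K : Set G}
    (hN : μ N = 0) (hK : IsCompact K) : μ (K ∩ N⁻¹) = 0 := by
  obtain ⟨L, hL, hKL⟩ := exists_compact_superset hK.inv
  obtain ⟨B, hB⟩ := (hL.bddAbove_image (continuous_modularCharacterFun μ).continuousOn)
  have hB' : ∀ x ∈ L, (modularCharacterFun x : ℝ) ≤ B := fun x hx => hB ⟨x, hx, rfl⟩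
  -- On `L` the modular function is at most `B`, so inversion enlarges open subsets of `L` by at
  -- most that factor. Inner regularity reduces this to a bump function, to which the inversion
  -- formula applies.
  have key : ∀ U : Set G, IsOpen U → U ⊆ L → μ U⁻¹ ≤ ENNReal.ofReal B * μ U := by
    intro U hU hUL
    have hUfin : μ U ≠ ∞ := ((measure_mono hUL).trans_lt hL.measure_lt_top).ne
    rw [hU.inv.measure_eq_iSup_isCompact]
    refine iSup₂_le fun M hMU => iSup_le fun hM => ?_
    obtain ⟨ψ, hψ1, hψ0, hψc, hψI⟩ := exists_continuous_one_zero_of_isCompact hM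
      hU.inv.isClosed_compl (Set.disjoint_compl_right_iff_subset.mpr hMU)
    have h1 : μ.real M ≤ ∫ x, ψ x ∂μ := by
      rw [← integral_indicator_one hM.measurableSet]
      refine integral_mono_of_nonneg (ae_of_all _ fun x => Set.indicator_nonneg (by simp) x)
        (ψ.continuous.integrable_of_hasCompactSupport hψc) (ae_of_all _ fun x => ?_)
      by_cases hx : x ∈ M
      · simp [hx, hψ1 hx]
      · simpa [hx] using (hψI x).1
    have h2 : ∫ x, ψ x ∂μ ≤ B * μ.real U := by
      rw [integral_inv_mul_modularCharacterFun_real μ ψ.continuous hψc, mul_comm B, ← smul_eq_mul,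
        ← setIntegral_const, ← integral_indicator hU.measurableSet]
      refine integral_mono_of_nonneg (ae_of_all _ fun x => mul_nonneg (NNReal.coe_nonneg _)
        (hψI _).1) ((integrable_indicator_iff hU.measurableSet).mpr (integrableOn_const hUfin))
        (ae_of_all _ fun x => ?_)
      by_cases hx : x ∈ U
      · simp only [hx, Set.indicator_of_mem]
        exact (mul_le_of_le_one_right (NNReal.coe_nonneg _) (hψI _).2).trans (hB' x (hUL hx))
      · have : ψ x⁻¹ = 0 := hψ0 (by simpa using hx)
        simp [hx, this]
    rw [← ENNReal.ofReal_toReal hM.measure_lt_top.ne, ← ENNReal.ofReal_toReal hUfin,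
      ← ENNReal.ofReal_mul' ENNReal.toReal_nonneg]
    exact ENNReal.ofReal_le_ofReal (h1.trans h2)
  refine le_antisymm (ENNReal.le_of_forall_pos_le_add fun ε hε _ => ?_) zero_le
  obtain ⟨δ, hδ0, hδε⟩ : ∃ δ : ℝ≥0∞, 0 < δ ∧ ENNReal.ofReal B * δ ≤ ε := by
    refine ⟨ε / (ENNReal.ofReal B + 1), ENNReal.div_pos (by simpa using hε.ne') (by simp), ?_⟩
    rw [← mul_div_assoc]
    refine ENNReal.div_le_of_le_mul ?_
    rw [mul_comm]
    gcongr
    exact le_self_add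
  obtain ⟨U, hNU, hU, hμU⟩ := Set.exists_isOpen_lt_of_lt N δ (by rwa [hN])
  calc μ (K ∩ N⁻¹) ≤ μ (U ∩ interior L)⁻¹ := by
        refine measure_mono fun x hx => ?_
        exact ⟨hNU hx.2, hKL (by simpa using hx.1)⟩
    _ ≤ ENNReal.ofReal B * μ (U ∩ interior L) :=
        key _ (hU.inter isOpen_interior) (Set.inter_subset_right.trans interior_subset)
    _ ≤ ENNReal.ofReal B * δ := by
        gcongr
        exact (measure_mono Set.inter_subset_left).trans hμU.le
    _ ≤ 0 + ε := by rwa [zero_add]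

end Haar

/-- By density of simple functions it suffices to treat `c · 1_t` with `t` of finite measure.
Regularity squeezes a compact `s ⊆ t` and an open `U ⊇ s`; a Urysohn function between them, times
`c`, errs only on `U \ s` and `t \ s`, by at most `‖c‖`. -/
theorem _root_.MeasureTheory.Integrable.exists_continuous_integral_sub_le {X : Type*}
    [TopologicalSpace X] [T2Space X] [LocallyCompactSpace X] [MeasurableSpace X] [BorelSpace X]
    {μ : Measure X} [μ.Regular] {f : X → ℂ} (hf : Integrable f μ) {ε : ℝ} (hε : 0 < ε) :
    ∃ g : X → ℂ, Continuous g ∧ HasCompactSupport g ∧ ∫ x, ‖f x - g x‖ ∂μ ≤ ε := by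
  have main : ∃ g : X → ℂ, eLpNorm (f - g) 1 μ ≤ ENNReal.ofReal ε ∧
      (Continuous g ∧ HasCompactSupport g) := by
    refine (memLp_one_iff_integrable.mpr hf).induction_dense ENNReal.one_ne_top
      (fun g => Continuous g ∧ HasCompactSupport g) ?_ ?_ ?_ (by simpa using hε)
    · intro c t ht htμ δ hδ
      obtain ⟨η, hη, hηδ⟩ : ∃ η : ℝ≥0∞, η ≠ 0 ∧ ‖c‖ₑ * (η + η) ≤ δ := by
        obtain ⟨η, hη0, hη⟩ := ENNReal.exists_pos_mul_lt (a := ‖c‖ₑ) (b := δ / 2) (by simp)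
          (by simpa using hδ)
        refine ⟨η, hη0.ne', ?_⟩
        rw [mul_add, mul_comm, ← ENNReal.add_halves δ]
        exact add_le_add hη.le hη.le
      obtain ⟨s, hst, hs, hsμ⟩ := ht.exists_isCompact_sdiff_lt htμ.ne hη
      obtain ⟨U, hsU, hU, hUμ, hUs⟩ := hs.measurableSet.exists_isOpen_sdiff_lt
        (hs.measure_lt_top (μ := μ)).ne hη
      obtain ⟨ψ, hψ1, hψ0, hψc, hψI⟩ := exists_continuous_one_zero_of_isCompact hs
        hU.isClosed_compl (Set.disjoint_compl_right_iff_subset.mpr hsU)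
      refine ⟨fun x => (ψ x : ℂ) * c, ?_, by fun_prop,
        (hψc.comp_left (g := fun r : ℝ => (r : ℂ)) (by simp)).mul_right⟩
      have hm1 : MeasurableSet (U \ s) := hU.measurableSet.diff hs.measurableSet
      have hm2 : MeasurableSet (t \ s) := ht.diff hs.measurableSet
      calc eLpNorm ((fun x => (ψ x : ℂ) * c) - t.indicator fun _ => c) 1 μ
          ≤ eLpNorm ((U \ s).indicator (fun _ => c) ) 1 μ
            + eLpNorm ((t \ s).indicator (fun _ => c)) 1 μ := by
            rw [eLpNorm_one_eq_lintegral_enorm, eLpNorm_one_eq_lintegral_enorm,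
              eLpNorm_one_eq_lintegral_enorm, ← lintegral_add_left'
                (aestronglyMeasurable_const.indicator hm1).enorm]
            refine lintegral_mono fun x => ?_
            have hψ2 : ‖(ψ x : ℂ)‖ ≤ 1 := by
              rw [Complex.norm_real, Real.norm_of_nonneg (hψI x).1]; exact (hψI x).2
            have hψ3 : ‖(ψ x : ℂ) - 1‖ ≤ 1 := by
              rw [← Complex.ofReal_one, ← Complex.ofReal_sub, Complex.norm_real, Real.norm_eq_abs,
                abs_le]
              constructor <;> linarith [(hψI x).1, (hψI x).2]
            simp only [← ofReal_norm]
            rw [← ENNReal.ofReal_add (norm_nonneg _) (norm_nonneg _)]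
            refine ENNReal.ofReal_le_ofReal ?_
            by_cases hxs : x ∈ s
            · simp [hψ1 hxs, hst hxs, hxs]
            · by_cases hxt : x ∈ t
              · have h1 : ‖(ψ x : ℂ) * c - c‖ ≤ ‖c‖ := by
                  rw [← sub_one_mul, norm_mul]
                  exact mul_le_of_le_one_left (norm_nonneg _) hψ3
                have h2 := norm_nonneg ((U \ s).indicator (fun _ => c) x)
                simp only [Pi.sub_apply, hxt, Set.indicator_of_mem, Set.mem_sdiff, hxs,
                  not_false_eq_true, and_self]
                linarith
              · by_cases hxU : x ∈ U
                · simp only [Pi.sub_apply, hxt, hxU, Set.indicator_of_mem, Set.mem_sdiff, hxs,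
                    not_false_eq_true, and_self, Set.indicator_of_notMem, false_and, sub_zero,
                    norm_zero, add_zero, norm_mul]
                  exact mul_le_of_le_one_left (norm_nonneg _) hψ2
                · have : ψ x = 0 := hψ0 hxU
                  simp [this, hxt, hxU]
        _ ≤ ‖c‖ₑ * η + ‖c‖ₑ * η := by
            rw [eLpNorm_indicator_const hm1 one_ne_zero ENNReal.one_ne_top,
              eLpNorm_indicator_const hm2 one_ne_zero ENNReal.one_ne_top]
            simp only [ENNReal.toReal_one, div_one, ENNReal.rpow_one]
            gcongr
        _ ≤ δ := by rwa [← mul_add]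
    · exact fun f g hf hg => ⟨hf.1.add hg.1, hf.2.add hg.2⟩
    · exact fun f hf => (hf.1.integrable_of_hasCompactSupport hf.2).aestronglyMeasurable
  obtain ⟨g, hg, hgc, hgs⟩ := main
  refine ⟨g, hgc, hgs, ?_⟩
  have hi : Integrable (fun x => f x - g x) μ := hf.sub (hgc.integrable_of_hasCompactSupport hgs)
  rw [integral_norm_eq_lintegral_enorm hi.aestronglyMeasurable]
  refine ENNReal.toReal_le_of_le_ofReal hε.le ?_
  rwa [eLpNorm_one_eq_lintegral_enorm] at hg

/-! ### The pairing of `L_∞(G, w⁻¹)` with `L₁(G, w)`. -/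

section Pairing
variable {G : Type u} [Group G] [TopologicalSpace G] [IsTopologicalGroup G] [T2Space G]
  [LocallyCompactSpace G] [MeasurableSpace G] [BorelSpace G]
  {μ : Measure G} [μ.IsHaarMeasure] [μ.Regular] {w : Weight G} {C : ℝ} {f g h : G → ℂ}

@[fun_prop]
theorem Weight.continuous (w : Weight G) : Continuous fun x => w x := w.continuous'

theorem Weight.ofReal_ne_zero (w : Weight G) (x : G) : (w x : ℂ) ≠ 0 :=
  Complex.ofReal_ne_zero.mpr (w.pos' x).ne'

theorem Weight.norm_ofReal (w : Weight G) (x : G) : ‖(w x : ℂ)‖ = w x := by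
  rw [Complex.norm_real, Real.norm_of_nonneg (w.pos' x).le]

theorem memL1_of_continuous (μ : Measure G) [μ.IsHaarMeasure] (w : Weight G)
    (hf : Continuous f) (h'f : HasCompactSupport f) : MemL1 μ w f :=
  Continuous.integrable_of_hasCompactSupport
    ((Complex.continuous_ofReal.comp w.continuous).mul hf) h'f.mul_left

theorem MemL1.integrable_norm (hf : MemL1 μ w f) : Integrable (fun x => w x * ‖f x‖) μ := by
  simpa only [norm_mul, Weight.norm_ofReal] using Integrable.norm hf

theorem MemL1.aestronglyMeasurable (hf : MemL1 μ w f) : AEStronglyMeasurable f μ := by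
  have h1 : Continuous fun x => (w x : ℂ)⁻¹ :=
    (Complex.continuous_ofReal.comp w.continuous).inv₀ w.ofReal_ne_zero
  refine (h1.aestronglyMeasurable.mul (Integrable.aestronglyMeasurable hf)).congr
    (ae_of_all _ fun x => ?_)
  simp [w.ofReal_ne_zero x]

theorem MemL1.sub (hf : MemL1 μ w f) (hg : MemL1 μ w g) : MemL1 μ w (fun x => f x - g x) := by
  refine (Integrable.sub hf hg).congr (ae_of_all _ fun x => ?_)
  simp [mul_sub]

theorem MemL1.exists_approx (hf : MemL1 μ w f) {ε : ℝ} (hε : 0 < ε) :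
    ∃ g : G → ℂ, Continuous g ∧ HasCompactSupport g ∧ ∫ x, w x * ‖f x - g x‖ ∂μ ≤ ε := by
  obtain ⟨g, hgcont, hgc, hg⟩ := Integrable.exists_continuous_integral_sub_le hf hε
  have h1 : Continuous fun x => (w x : ℂ)⁻¹ :=
    (Complex.continuous_ofReal.comp w.continuous).inv₀ w.ofReal_ne_zero
  refine ⟨fun x => (w x : ℂ)⁻¹ * g x, h1.mul hgcont, hgc.mul_left, ?_⟩
  refine le_of_eq_of_le (integral_congr_ae (ae_of_all _ fun x => ?_)) hg
  have : (w x : ℂ) * f x - g x = (w x : ℂ) * (f x - (w x : ℂ)⁻¹ * g x) := by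
    have := w.ofReal_ne_zero x
    field_simp
  simp only [this, norm_mul, Weight.norm_ofReal]

/-- Up to a set of small weighted measure, `f ∈ L₁(G, w)` lives on a compact set. -/
theorem MemL1.exists_compact_tail (hf : MemL1 μ w f) {ε : ℝ} (hε : 0 < ε) :
    ∃ K : Set G, IsCompact K ∧ ∫ x in Kᶜ, w x * ‖f x‖ ∂μ ≤ ε := by
  obtain ⟨g, hg, h'g, hfg⟩ := hf.exists_approx hε
  have hK : IsCompact (tsupport g) := h'g
  refine ⟨tsupport g, hK, le_trans ?_ hfg⟩
  have hi := (hf.sub (memL1_of_continuous μ w hg h'g)).integrable_norm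
  calc ∫ x in (tsupport g)ᶜ, w x * ‖f x‖ ∂μ
      = ∫ x in (tsupport g)ᶜ, w x * ‖f x - g x‖ ∂μ :=
        setIntegral_congr_fun hK.measurableSet.compl fun x hx => by
          simp [image_eq_zero_of_notMem_tsupport hx]
    _ ≤ ∫ x, w x * ‖f x - g x‖ ∂μ :=
        setIntegral_le_integral hi (ae_of_all _ fun x =>
          mul_nonneg (w.pos' x).le (norm_nonneg _))

/-- A series which converges absolutely in `L₁(G, w)` converges absolutely almost everywhere. -/
theorem ae_summable_norm {ι : Type*} [Countable ι] {k : ι → G → ℂ} (hk : ∀ n, MemL1 μ w (k n))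
    (hks : Summable fun n => ∫ x, w x * ‖k n x‖ ∂μ) :
    ∀ᵐ x ∂μ, Summable fun n => ‖k n x‖ := by
  have h1 : ∫⁻ x, ∑' n, ENNReal.ofReal (w x * ‖k n x‖) ∂μ ≠ ∞ := by
    rw [lintegral_tsum fun n => (hk n).integrable_norm.aemeasurable.ennreal_ofReal]
    have h2 : ∀ n, ∫⁻ x, ENNReal.ofReal (w x * ‖k n x‖) ∂μ
        = ENNReal.ofReal (∫ x, w x * ‖k n x‖ ∂μ) := fun n =>
      (ofReal_integral_eq_lintegral_ofReal (hk n).integrable_norm (ae_of_all _ fun x =>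
        mul_nonneg (w.pos' x).le (norm_nonneg _))).symm
    simp only [h2]
    exact hks.tsum_ofReal_ne_top
  have h3 : AEMeasurable (fun x => ∑' n, ENNReal.ofReal (w x * ‖k n x‖)) μ :=
    AEMeasurable.tsum fun n => (hk n).integrable_norm.aemeasurable.ennreal_ofReal
  filter_upwards [ae_lt_top' h3 h1] with x hx
  have h4 := ENNReal.summable_toReal hx.ne
  simp only [ENNReal.toReal_ofReal (mul_nonneg (w.pos' x).le (norm_nonneg _))] at h4
  exact (summable_mul_left_iff (w.pos' x).ne').mp h4

/-- An element of `L₁(G, w)` is the almost everywhere sum of an absolutely convergent series of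
continuous functions with compact support. -/
theorem MemL1.exists_hasSum (hf : MemL1 μ w f) :
    ∃ F : ℕ → G → ℂ, (∀ n, Continuous (F n)) ∧ (∀ n, HasCompactSupport (F n)) ∧
      (Summable fun n => ∫ x, w x * ‖F n x‖ ∂μ) ∧
      ∀ᵐ x ∂μ, (Summable fun n => ‖F n x‖) ∧ HasSum (fun n => F n x) (f x) := by
  choose u hu h'u huf using fun n : ℕ => hf.exists_approx (ε := (1 / 2) ^ n) (by positivity)
  have hm : ∀ n, MemL1 μ w (u n) := fun n => memL1_of_continuous μ w (hu n) (h'u n)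
  -- The approximants are shifted by one and started at `0`, so that the partial sums of `v (n + 1)
  -- - v n` telescope to `v n`.
  obtain ⟨v, hv0, hvs⟩ : ∃ v : ℕ → G → ℂ, v 0 = 0 ∧ ∀ n, v (n + 1) = u n :=
    ⟨fun n => Nat.casesOn n 0 u, rfl, fun _ => rfl⟩
  have hv : ∀ n, Continuous (v n) := fun n => by
    cases n with
    | zero => rw [hv0]; exact continuous_const
    | succ n => rw [hvs]; exact hu n
  have h'v : ∀ n, HasCompactSupport (v n) := fun n => by
    cases n with
    | zero => rw [hv0]; exact HasCompactSupport.zero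
    | succ n => rw [hvs]; exact h'u n
  have hmv : ∀ n, MemL1 μ w (v n) := fun n => memL1_of_continuous μ w (hv n) (h'v n)
  have hs : Summable fun n => ∫ x, w x * ‖f x - u n x‖ ∂μ :=
    Summable.of_nonneg_of_le (fun n => integral_nonneg fun x =>
      mul_nonneg (w.pos' x).le (norm_nonneg _)) huf
      (summable_geometric_of_lt_one (by norm_num) (by norm_num))
  have hsv : Summable fun n => ∫ x, w x * ‖f x - v n x‖ ∂μ :=
    (summable_nat_add_iff 1).mp (by simpa only [hvs] using hs)
  have hsF : Summable fun n => ∫ x, w x * ‖v (n + 1) x - v n x‖ ∂μ := by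
    refine Summable.of_nonneg_of_le (fun n => integral_nonneg fun x =>
      mul_nonneg (w.pos' x).le (norm_nonneg _)) (fun n => ?_) (hs.add hsv)
    rw [← integral_add ((hf.sub (hm n)).integrable_norm) ((hf.sub (hmv n)).integrable_norm)]
    refine integral_mono ((hmv (n + 1)).sub (hmv n)).integrable_norm
      (((hf.sub (hm n)).integrable_norm).add ((hf.sub (hmv n)).integrable_norm)) fun x => ?_
    simp only [← mul_add]
    refine mul_le_mul_of_nonneg_left ?_ (w.pos' x).le
    have : v (n + 1) x - v n x = (f x - v n x) - (f x - u n x) := by simp [hvs]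
    rw [this, add_comm]
    exact norm_sub_le _ _
  refine ⟨fun n x => v (n + 1) x - v n x, fun n => (hv _).sub (hv n),
    fun n => (h'v _).sub (h'v n), hsF, ?_⟩
  filter_upwards [ae_summable_norm (fun n => (hmv (n + 1)).sub (hmv n)) hsF,
    ae_summable_norm (fun n => hf.sub (hmv n)) hsv] with x h1 h2
  have h3 : Tendsto (fun n => v n x) atTop (𝓝 (f x)) := by
    have := (tendsto_const_nhds (x := f x)).sub
      (tendsto_zero_iff_norm_tendsto_zero.mpr h2.tendsto_atTop_zero)
    simpa using this
  refine ⟨h1, ?_⟩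
  rw [hasSum_iff_tendsto_nat_of_summable_norm h1]
  simp only [Finset.sum_range_sub (fun n => v n x)]
  simpa [hv0] using h3

/-- Integrable functions live on σ-compact sets. This turns bounds and measurability of `h` on
compact sets into almost everywhere statements about products `h g`. -/
theorem MemL1.exists_compacts (hf : MemL1 μ w f) :
    ∃ K : ℕ → Set G, (∀ n, IsCompact (K n)) ∧ ∀ᵐ x ∂μ, x ∉ ⋃ n, K n → f x = 0 := by
  obtain ⟨F, -, hF, -, hs⟩ := hf.exists_hasSum
  refine ⟨fun n => tsupport (F n), hF, ?_⟩
  filter_upwards [hs] with x hx hxn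
  rw [Set.mem_iUnion, not_exists] at hxn
  refine hx.2.unique ?_
  simp only [fun n => image_eq_zero_of_notMem_tsupport (hxn n)]
  exact hasSum_zero

theorem LinfBound.ae_norm_le (hh : LinfBound μ w C h) {K : Set G} (hK : IsCompact K) :
    ∀ᵐ x ∂μ.restrict K, ‖h x‖ ≤ C * w x := by
  filter_upwards [(hh K hK).2] with x hx
  rwa [inv_mul_le_iff₀ (w.pos' x), mul_comm] at hx

theorem LinfBound.mono (hh : LinfBound μ w C h) {D : ℝ} (hCD : C ≤ D) : LinfBound μ w D h :=
  fun K hK => ⟨(hh K hK).1, (hh K hK).2.mono fun _ hx => hx.trans hCD⟩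

theorem linfBound_of_ae_norm_le
    (hm : ∀ K : Set G, IsCompact K → AEStronglyMeasurable h (μ.restrict K))
    (hb : ∀ K : Set G, IsCompact K → ∀ᵐ x ∂μ.restrict K, ‖h x‖ ≤ C * w x) : LinfBound μ w C h :=
  fun K hK => ⟨hm K hK, (hb K hK).mono fun x hx => by
    rwa [inv_mul_le_iff₀ (w.pos' x), mul_comm]⟩

/-- Right translation multiplies `μ` by a constant, so it respects null sets; hence `h(· a)` is
again locally measurable. -/
theorem quasiMeasurePreserving_mul_right_restrict (a : G) {K : Set G} (hK : IsCompact K) :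
    QuasiMeasurePreserving (· * a) (μ.restrict K)
      (μ.restrict ((· * a) '' K)) := by
  have hK' : IsCompact ((· * a) '' K) := hK.image (by fun_prop)
  refine ⟨measurable_mul_const a, ?_⟩
  refine AbsolutelyContinuous.mk fun s hs h0 => ?_
  rw [Measure.restrict_apply hs] at h0
  rw [Measure.map_apply (measurable_mul_const a) hs,
    Measure.restrict_apply (measurable_mul_const a hs)]
  have h1 : μ.map (· * a) (s ∩ (· * a) '' K) = 0 := by
    rw [map_mul_right_eq, Measure.smul_apply, h0, smul_zero]
  rw [Measure.map_apply (measurable_mul_const a) (hs.inter hK'.measurableSet)] at h1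
  refine measure_mono_null (fun x hx => ?_) h1
  exact ⟨hx.1, x, hx.2, rfl⟩

theorem LinfBound.comp_mul_right (hC : 0 ≤ C) (hh : LinfBound μ w C h) (a : G) :
    LinfBound μ w (C * w a) (fun x => h (x * a)) := by
  refine linfBound_of_ae_norm_le (fun K hK => ?_) (fun K hK => ?_)
  · exact (hh _ (hK.image (by fun_prop))).1.comp_quasiMeasurePreserving
      (quasiMeasurePreserving_mul_right_restrict a hK)
  · filter_upwards [(quasiMeasurePreserving_mul_right_restrict a hK).ae
      (hh.ae_norm_le (hK.image (by fun_prop)))] with x hx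
    calc ‖h (x * a)‖ ≤ C * w (x * a) := hx
      _ ≤ C * (w x * w a) := mul_le_mul_of_nonneg_left (w.mul_le' x a) hC
      _ = C * w a * w x := by ring

theorem LinfBound.ae_norm_mul_le (hh : LinfBound μ w C h) (hg : MemL1 μ w g) :
    ∀ᵐ x ∂μ, ‖h x * g x‖ ≤ C * (w x * ‖g x‖) := by
  obtain ⟨K, hK, hs⟩ := hg.exists_compacts
  have h1 : ∀ᵐ x ∂μ.restrict (⋃ n, K n), ‖h x‖ ≤ C * w x :=
    (ae_restrict_iUnion_iff _ _).mpr fun n => hh.ae_norm_le (hK n)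
  rw [ae_restrict_iff' (MeasurableSet.iUnion fun n => (hK n).measurableSet)] at h1
  filter_upwards [hs, h1] with x h2 h3
  by_cases hx : x ∈ ⋃ n, K n
  · rw [norm_mul, ← mul_assoc]
    exact mul_le_mul_of_nonneg_right (h3 hx) (norm_nonneg _)
  · simp [h2 hx]

theorem LinfBound.integrable_mul (hh : LinfBound μ w C h) (hg : MemL1 μ w g) :
    Integrable (fun x => h x * g x) μ := by
  refine Integrable.mono' (hg.integrable_norm.const_mul C) ?_ (hh.ae_norm_mul_le hg)
  obtain ⟨K, hK, hs⟩ := hg.exists_compacts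
  have hm : MeasurableSet (⋃ n, K n) := MeasurableSet.iUnion fun n => (hK n).measurableSet
  have h1 : AEStronglyMeasurable (fun x => h x * g x) (μ.restrict (⋃ n, K n)) :=
    (aestronglyMeasurable_iUnion_iff.mpr fun n => (hh _ (hK n)).1).mul
      hg.aestronglyMeasurable.restrict
  refine ((aestronglyMeasurable_indicator_iff hm).mpr h1).congr ?_
  filter_upwards [hs] with x h2
  by_cases hx : x ∈ ⋃ n, K n
  · simp only [hx, Set.indicator_of_mem]
  · simp [Set.indicator_of_notMem hx, h2 hx]

theorem LinfBound.integral_norm_mul_le (hh : LinfBound μ w C h) (hg : MemL1 μ w g) :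
    ∫ x, ‖h x * g x‖ ∂μ ≤ C * ∫ x, w x * ‖g x‖ ∂μ := by
  rw [← integral_const_mul]
  exact integral_mono_ae (hh.integrable_mul hg).norm (hg.integrable_norm.const_mul C)
    (hh.ae_norm_mul_le hg)

theorem LinfBound.norm_integral_mul_le (hh : LinfBound μ w C h) (hg : MemL1 μ w g) :
    ‖∫ x, h x * g x ∂μ‖ ≤ C * ∫ x, w x * ‖g x‖ ∂μ :=
  (norm_integral_le_integral_norm _).trans (hh.integral_norm_mul_le hg)

end Pairing

/-! ### The function `h ⊙ g` and its membership in `LUC(G, w⁻¹)`. -/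

section Translate
variable {G : Type u} [Group G] [TopologicalSpace G] [IsTopologicalGroup G] [T2Space G]
  [LocallyCompactSpace G] [MeasurableSpace G] [BorelSpace G]
  {μ : Measure G} [μ.IsHaarMeasure] [μ.Regular] {w : Weight G} {C : ℝ} {f g h : G → ℂ}

/-- The function `x ↦ ∫ h (t x) g t dt`, which represents `h ⊙ g`. -/
noncomputable def odot (μ : Measure G) (h g : G → ℂ) : G → ℂ := fun x => ∫ t, h (t * x) * g t ∂μ

theorem norm_odot_le (hC : 0 ≤ C) (hh : LinfBound μ w C h) (hg : MemL1 μ w g) (x : G) :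
    ‖odot μ h g x‖ ≤ C * (∫ t, w t * ‖g t‖ ∂μ) * w x := by
  refine ((hh.comp_mul_right hC x).norm_integral_mul_le hg).trans (le_of_eq (by ring))

theorem odot_sub_apply (hC : 0 ≤ C) (hh : LinfBound μ w C h) (hf : MemL1 μ w f)
    (hg : MemL1 μ w g) (x : G) :
    odot μ h (fun t => f t - g t) x = odot μ h f x - odot μ h g x := by
  have hx := hh.comp_mul_right hC x
  simp only [odot, mul_sub]
  exact integral_sub (hx.integrable_mul hf) (hx.integrable_mul hg)

/-- The translation by `y` is moved from `h`, which has no continuity, to `g`, where translation is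
continuous in the weighted `L₁` norm. -/
theorem odot_apply_eq (x y : G) :
    odot μ h g (y * x) = ∫ t, h (t * x) * ((modularCharacterFun y : ℝ) * g (t * y⁻¹)) ∂μ := by
  have h1 := integral_comp_mul_right μ (fun t => h (t * x) * g (t * y⁻¹)) y
  rw [← integral_smul] at h1
  simp only [mul_assoc, mul_inv_cancel, mul_one, Complex.real_smul] at h1
  rw [odot, h1]
  congr with t
  ring

theorem continuous_integral_weight_norm_sub (w : Weight G) (hg : Continuous g)
    (h'g : HasCompactSupport g) :
    Tendsto (fun y => ∫ t, w t * ‖(modularCharacterFun y : ℝ) * g (t * y⁻¹) - g t‖ ∂μ)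
      (𝓝 1) (𝓝 0) := by
  obtain ⟨V, hV, hV1⟩ := exists_compact_mem_nhds (1 : G)
  have hc := continuous_modularCharacterFun μ
  have hK : IsCompact (tsupport g) := h'g
  have h1 : ContinuousOn
      (fun y => ∫ t, w t * ‖(modularCharacterFun y : ℝ) * g (t * y⁻¹) - g t‖ ∂μ) V := by
    -- For `y` in the compact neighbourhood `V`, all integrands vanish off one compact set, `supp g
    -- · V ∪ supp g`.
    refine continuousOn_integral_of_compact_support ((hK.mul hV).union hK) ?_ ?_
    · have : Continuous fun p : G × G =>
          w p.2 * ‖((modularCharacterFun p.1 : ℝ) : ℂ) * g (p.2 * p.1⁻¹) - g p.2‖ := by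
        have h1 := w.continuous
        have h2 : Continuous fun p : G × G => ((modularCharacterFun p.1 : ℝ) : ℂ) :=
          Complex.continuous_ofReal.comp (hc.comp continuous_fst)
        exact (h1.comp continuous_snd).mul ((h2.mul (by fun_prop)).sub (by fun_prop)).norm
      exact this.continuousOn
    · intro y t hy ht
      have h2 : g t = 0 := image_eq_zero_of_notMem_tsupport fun h => ht (Or.inr h)
      have h3 : g (t * y⁻¹) = 0 := image_eq_zero_of_notMem_tsupport fun h =>
        ht (Or.inl ⟨_, h, y, hy, by simp⟩)
      simp [h2, h3]
  have h2 := (h1.continuousAt hV1).tendsto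
  simpa [modularCharacterFun_map_one] using h2

theorem odot_uniform_of_continuous (hC : 0 ≤ C) (hh : LinfBound μ w C h) (hg : Continuous g)
    (h'g : HasCompactSupport g) {ε : ℝ} (hε : 0 < ε) :
    ∀ᶠ y in 𝓝 (1 : G), ∀ x, ‖odot μ h g (y * x) - odot μ h g x‖ ≤ ε * w x := by
  have h1 := (continuous_integral_weight_norm_sub (μ := μ) w hg h'g).const_mul C
  rw [mul_zero] at h1
  filter_upwards [h1.eventually_le_const hε] with y hy x
  have hx := hh.comp_mul_right hC x
  have hgm := memL1_of_continuous μ w hg h'g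
  have hgy : MemL1 μ w (fun t => (modularCharacterFun y : ℝ) * g (t * y⁻¹)) :=
    memL1_of_continuous μ w (by fun_prop)
      (HasCompactSupport.mul_left (h'g.comp_homeomorph (Homeomorph.mulRight y⁻¹)))
  rw [odot_apply_eq, odot, ← integral_sub (hx.integrable_mul hgy) (hx.integrable_mul hgm)]
  simp only [← mul_sub]
  refine (hx.norm_integral_mul_le (hgy.sub hgm)).trans ?_
  rw [mul_right_comm]
  exact mul_le_mul_of_nonneg_right hy (w.pos' x).le

theorem integral_weight_norm_nonneg : 0 ≤ ∫ x, w x * ‖f x‖ ∂μ :=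
  integral_nonneg fun x => mul_nonneg (w.pos' x).le (norm_nonneg _)

theorem odot_uniform (hC : 0 ≤ C) (hh : LinfBound μ w C h) (hg : MemL1 μ w g) {ε : ℝ}
    (hε : 0 < ε) :
    ∀ᶠ y in 𝓝 (1 : G), ∀ x, ‖odot μ h g (y * x) - odot μ h g x‖ ≤ ε * w x := by
  -- The `+ 1` covers `C = 0`. The approximation error enters at `y x`, where `w (y x) ≤ 2 w x`
  -- doubles it, and at `x`; with the `ε / 4` for `g₁` the total is `ε w x`.
  obtain ⟨g₁, hg₁, h'g₁, hgg⟩ := hg.exists_approx (ε := ε / (4 * (C + 1))) (by positivity)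
  have hm := memL1_of_continuous μ w hg₁ h'g₁
  have hCε : C * ∫ x, w x * ‖g x - g₁ x‖ ∂μ ≤ ε / 4 := by
    calc C * ∫ x, w x * ‖g x - g₁ x‖ ∂μ ≤ (C + 1) * (ε / (4 * (C + 1))) :=
          mul_le_mul (by linarith) hgg integral_weight_norm_nonneg (by linarith)
      _ = ε / 4 := by field_simp
  have hd : ∀ x, ‖odot μ h g x - odot μ h g₁ x‖ ≤ ε / 4 * w x := fun x => by
    rw [← odot_sub_apply hC hh hg hm]
    exact (norm_odot_le hC hh (hg.sub hm) x).trans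
      (mul_le_mul_of_nonneg_right hCε (w.pos' x).le)
  have hw : ∀ᶠ y in 𝓝 (1 : G), w y ≤ 2 :=
    (w.continuous.tendsto' 1 1 w.one').eventually_le_const (by norm_num)
  filter_upwards [hw, odot_uniform_of_continuous hC hh hg₁ h'g₁ (ε := ε / 4) (by positivity)]
    with y hy h1 x
  have h2 : w (y * x) ≤ 2 * w x :=
    (w.mul_le' y x).trans (mul_le_mul_of_nonneg_right hy (w.pos' x).le)
  have h3 : odot μ h g (y * x) - odot μ h g x
      = (odot μ h g (y * x) - odot μ h g₁ (y * x)) + (odot μ h g₁ (y * x) - odot μ h g₁ x)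
        - (odot μ h g x - odot μ h g₁ x) := by ring
  rw [h3]
  calc _ ≤ ε / 4 * w (y * x) + ε / 4 * w x + ε / 4 * w x :=
        (norm_sub_le _ _).trans (add_le_add ((norm_add_le _ _).trans
          (add_le_add (hd _) (h1 x))) (hd x))
    _ ≤ ε / 4 * (2 * w x) + ε / 4 * w x + ε / 4 * w x := by gcongr
    _ = ε * w x := by ring

/-- Submultiplicativity puts `w(yx) / w(x)` between `w(y⁻¹)⁻¹` and `w(y)`, which both tend to `1` as
`y → 1`, uniformly in `x`. Division by `w` therefore preserves the uniform estimate. -/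
theorem isLUC_of_uniform {φ : G → ℂ} {B : ℝ} (hB : ∀ x, ‖φ x‖ ≤ B * w x)
    (hφ : ∀ ε : ℝ, 0 < ε → ∀ᶠ y in 𝓝 (1 : G), ∀ x, ‖φ (y * x) - φ x‖ ≤ ε * w x) :
    IsLUC fun x => ((w x)⁻¹ : ℂ) * φ x := by
  have hwi : ∀ x, ‖((w x)⁻¹ : ℂ)‖ = (w x)⁻¹ := fun x => by rw [norm_inv, w.norm_ofReal]
  have hB0 : 0 ≤ B := by
    have := (norm_nonneg _).trans (hB 1)
    rwa [w.one', mul_one] at this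
  have hu : ∀ ε : ℝ, 0 < ε → ∀ᶠ y in 𝓝 (1 : G), ∀ x,
      ‖((w (y * x))⁻¹ : ℂ) * φ (y * x) - ((w x)⁻¹ : ℂ) * φ x‖ ≤ ε := by
    intro ε hε
    have hw : Tendsto (fun y => B * (|w y - 1| + |1 - (w y⁻¹)⁻¹|)) (𝓝 1) (𝓝 0) := by
      have hc : Continuous fun y => B * (|w y - 1| + |1 - (w y⁻¹)⁻¹|) := by
        have h1 : Continuous fun y => (w y⁻¹)⁻¹ :=
          (w.continuous.comp continuous_inv).inv₀ fun y => (w.pos' _).ne'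
        have := w.continuous
        fun_prop
      exact hc.tendsto' 1 0 (by simp [w.one'])
    filter_upwards [hw.eventually_le_const (half_pos hε), hφ (ε / 2) (half_pos hε)]
      with y hy h1 x
    have hx := w.pos' x
    have hyx := w.pos' (y * x)
    have e : ((w (y * x))⁻¹ : ℂ) * φ (y * x) - ((w x)⁻¹ : ℂ) * φ x
        = ((w x)⁻¹ : ℂ) * (φ (y * x) - φ x) + ((w (y * x) : ℂ)⁻¹ - (w x : ℂ)⁻¹) * φ (y * x) := by
      ring
    have h2 : ‖((w x)⁻¹ : ℂ) * (φ (y * x) - φ x)‖ ≤ ε / 2 := by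
      rw [norm_mul, hwi, inv_mul_le_iff₀ hx, mul_comm]
      exact h1 x
    have h3 : ‖((w (y * x) : ℂ)⁻¹ - (w x : ℂ)⁻¹) * φ (y * x)‖ ≤ ε / 2 := by
      have h4 : ‖((w (y * x) : ℂ)⁻¹ - (w x : ℂ)⁻¹)‖ = |1 - w (y * x) / w x| / w (y * x) := by
        rw [← Complex.ofReal_inv, ← Complex.ofReal_inv, ← Complex.ofReal_sub, Complex.norm_real,
          Real.norm_eq_abs, eq_div_iff hyx.ne']
        nth_rewrite 2 [← abs_of_pos hyx]
        rw [← abs_mul]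
        congr 1
        field_simp
      have h5 : w (y * x) / w x ≤ w y := by
        rw [div_le_iff₀ hx]; exact w.mul_le' y x
      have h6 : (w y⁻¹)⁻¹ ≤ w (y * x) / w x := by
        rw [le_div_iff₀ hx, inv_mul_le_iff₀ (w.pos' _)]
        simpa using w.mul_le' y⁻¹ (y * x)
      have h7 : |1 - w (y * x) / w x| ≤ |w y - 1| + |1 - (w y⁻¹)⁻¹| := by
        rw [abs_le]
        constructor
        · linarith [le_abs_self (w y - 1), abs_nonneg (1 - (w y⁻¹)⁻¹)]
        · linarith [le_abs_self (1 - (w y⁻¹)⁻¹), abs_nonneg (w y - 1)]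
      rw [norm_mul, h4]
      calc |1 - w (y * x) / w x| / w (y * x) * ‖φ (y * x)‖
          ≤ |1 - w (y * x) / w x| / w (y * x) * (B * w (y * x)) := by
            gcongr; exact hB _
        _ = B * |1 - w (y * x) / w x| := by field_simp
        _ ≤ B * (|w y - 1| + |1 - (w y⁻¹)⁻¹|) := by gcongr
        _ ≤ ε / 2 := hy
    rw [e]
    linarith [norm_add_le (((w x)⁻¹ : ℂ) * (φ (y * x) - φ x))
      (((w (y * x) : ℂ)⁻¹ - (w x : ℂ)⁻¹) * φ (y * x))]
  refine ⟨continuous_iff_continuousAt.mpr fun x => ?_, ⟨B, fun x => ?_⟩, hu⟩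
  · rw [ContinuousAt, ← map_mul_right_nhds_one x, tendsto_map'_iff, Metric.tendsto_nhds]
    intro ε hε
    filter_upwards [hu (ε / 2) (half_pos hε)] with y hy
    rw [Function.comp_apply, dist_eq_norm]
    linarith [hy x]
  · rw [norm_mul, hwi, inv_mul_le_iff₀ (w.pos' x), mul_comm]
    exact hB x

/-- `h ⊙ g` as an element of `LUC(G, w⁻¹)`. -/
noncomputable def odotLUC (hC : 0 ≤ C) (hh : LinfBound μ w C h) (hg : MemL1 μ w g) : LUCw w :=
  ⟨odot μ h g, isLUC_of_uniform (norm_odot_le hC hh hg) fun _ hε => odot_uniform hC hh hg hε⟩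

theorem odotLUC_val (hC : 0 ≤ C) (hh : LinfBound μ w C h) (hg : MemL1 μ w g) :
    (odotLUC hC hh hg).val = odot μ h g := rfl

theorem LUCw.continuous_val (φ : LUCw w) : Continuous φ.val := by
  have h := (Complex.continuous_ofReal.comp w.continuous).mul φ.isLUC.continuous
  refine h.congr fun x => ?_
  simp [w.ofReal_ne_zero x]

theorem linfBound_of_continuous {φ : G → ℂ} (hφ : Continuous φ) (hB : ∀ x, ‖φ x‖ ≤ C * w x) :
    LinfBound μ w C φ :=
  linfBound_of_ae_norm_le (fun _ _ => hφ.aestronglyMeasurable) fun _ _ => ae_of_all _ hB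

theorem linfBound_odot (hC : 0 ≤ C) (hh : LinfBound μ w C h) (hg : MemL1 μ w g) :
    LinfBound μ w (C * ∫ t, w t * ‖g t‖ ∂μ) (odot μ h g) :=
  linfBound_of_continuous (odotLUC hC hh hg).continuous_val (norm_odot_le hC hh hg)

end Translate

/-! ### Fubini and convolution for continuous compactly supported functions. -/

section Convolution
variable {G : Type u} [Group G] [TopologicalSpace G] [IsTopologicalGroup G] [T2Space G]
  [LocallyCompactSpace G] [MeasurableSpace G] [BorelSpace G]
  {μ : Measure G} [μ.IsHaarMeasure] [μ.Regular] {w : Weight G} {C : ℝ} {f g h : G → ℂ}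

/-- Fubini's theorem for a locally measurable function of one variable times a continuous
compactly supported kernel. -/
theorem LinfBound.integral_integral_swap (hh : LinfBound μ w C h) {k : G × G → ℂ}
    (hk : Continuous k) (h'k : HasCompactSupport k) :
    ∫ x, ∫ s, h s * k (s, x) ∂μ ∂μ = ∫ s, h s * ∫ x, k (s, x) ∂μ ∂μ := by
  have hK : IsCompact (tsupport k) := h'k
  -- Haar measure need not be σ-finite. On the two compact projections of the support of `k` it is
  -- finite and `h` is integrable, so the usual Fubini theorem applies there.
  set L := Prod.fst '' tsupport k
  set M := Prod.snd '' tsupport k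
  have hL : IsCompact L := hK.image continuous_fst
  have hM : IsCompact M := hK.image continuous_snd
  have hkL : ∀ s x, s ∉ L → k (s, x) = 0 := fun s x hs =>
    image_eq_zero_of_notMem_tsupport fun h => hs ⟨_, h, rfl⟩
  have hkM : ∀ s x, x ∉ M → k (s, x) = 0 := fun s x hx =>
    image_eq_zero_of_notMem_tsupport fun h => hx ⟨_, h, rfl⟩
  have fL : IsFiniteMeasure (μ.restrict L) := ⟨by simpa using hL.measure_lt_top⟩
  have fM : IsFiniteMeasure (μ.restrict M) := ⟨by simpa using hM.measure_lt_top⟩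
  have hhL : Integrable h (μ.restrict L) := by
    obtain ⟨B, hB⟩ := hL.bddAbove_image w.continuous.continuousOn
    refine Integrable.of_bound (hh L hL).1 (|C| * B) ?_
    filter_upwards [hh.ae_norm_le hL, ae_restrict_mem hL.measurableSet] with s hs hsL
    refine hs.trans ((mul_le_mul_of_nonneg_right (le_abs_self C) (w.pos' s).le).trans ?_)
    exact mul_le_mul_of_nonneg_left (hB ⟨s, hsL, rfl⟩) (abs_nonneg C)
  obtain ⟨D, hD⟩ := h'k.exists_bound_of_continuous hk
  have hi : Integrable (fun p : G × G => h p.1 * k p) ((μ.restrict L).prod (μ.restrict M)) :=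
    (hhL.comp_fst (μ.restrict M)).mul_bdd
      (h'k.stronglyMeasurable_of_prod hk).aestronglyMeasurable (ae_of_all _ hD)
  have e1 : ∀ x, ∫ s, h s * k (s, x) ∂μ = ∫ s in L, h s * k (s, x) ∂μ := fun x =>
    (setIntegral_eq_integral_of_forall_compl_eq_zero fun s hs => by simp [hkL s x hs]).symm
  have e2 : ∀ s, ∫ x, k (s, x) ∂μ = ∫ x in M, k (s, x) ∂μ := fun s =>
    (setIntegral_eq_integral_of_forall_compl_eq_zero fun x hx => hkM s x hx).symm
  calc ∫ x, ∫ s, h s * k (s, x) ∂μ ∂μ = ∫ x in M, ∫ s in L, h s * k (s, x) ∂μ ∂μ := by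
        simp only [e1]
        exact (setIntegral_eq_integral_of_forall_compl_eq_zero fun x hx => by
          simp [hkM _ x hx]).symm
    _ = ∫ s in L, ∫ x in M, h s * k (s, x) ∂μ ∂μ :=
        (MeasureTheory.integral_integral_swap (f := fun s x => h s * k (s, x)) hi).symm
    _ = ∫ s, h s * ∫ x, k (s, x) ∂μ ∂μ := by
        simp only [e2, integral_const_mul]
        exact setIntegral_eq_integral_of_forall_compl_eq_zero fun s hs => by
          simp [hkL s _ hs]

/-- Substitute `t = s x`, then invert `x`. The result has the same kernel as `h ⊙ g` after a right
translation of its integration variable. -/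
theorem conv_eq_integral (hf : Continuous f) (hg : Continuous g) (h'f : HasCompactSupport f)
    (s : G) :
    conv μ g f s = ∫ x, g (s * x⁻¹) * ((modularCharacterFun x : ℝ) * f x) ∂μ := by
  have h1 : Continuous fun x => g (s * x) * f x⁻¹ := by fun_prop
  have h2 : HasCompactSupport fun x => g (s * x) * f x⁻¹ :=
    (hasCompactSupport_comp_inv h'f).mul_left
  have h3 := integral_inv_mul_modularCharacterFun μ h1 h2
  have h4 := integral_mul_left_eq_self (μ := μ) (fun t => g t * f (t⁻¹ * s)) s
  simp only [mul_inv_rev, inv_mul_cancel_right] at h4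
  rw [conv, ← h4, h3]
  congr with x
  rw [inv_inv]
  ring

/-- Both sides are iterated integrals of `h(s) g(s x⁻¹) Δ(x) f(x)`, in the two orders. -/
theorem integral_mul_conv_of_continuous (hh : LinfBound μ w C h) (hg : Continuous g)
    (h'g : HasCompactSupport g) (hf : Continuous f) (h'f : HasCompactSupport f) :
    ∫ x, h x * conv μ g f x ∂μ = ∫ x, odot μ h g x * f x ∂μ := by
  have hc := continuous_modularCharacterFun μ
  have hKf : IsCompact (tsupport f) := h'f
  have hKg : IsCompact (tsupport g) := h'g
  let k : G × G → ℂ := fun p => g (p.1 * p.2⁻¹) * ((modularCharacterFun p.2 : ℝ) * f p.2)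
  have hk : Continuous k := by
    have h2 : Continuous fun p : G × G => ((modularCharacterFun p.2 : ℝ) : ℂ) :=
      Complex.continuous_ofReal.comp (hc.comp continuous_snd)
    exact Continuous.mul (by fun_prop) (h2.mul (by fun_prop))
  have h'k : HasCompactSupport k := by
    refine HasCompactSupport.intro ((hKg.mul hKf).prod hKf) fun p hp => ?_
    by_cases h1 : p.2 ∈ tsupport f
    · have : g (p.1 * p.2⁻¹) = 0 := image_eq_zero_of_notMem_tsupport fun h2 =>
        hp ⟨⟨_, h2, _, h1, by simp⟩, h1⟩
      simp [k, this]
    · simp [k, image_eq_zero_of_notMem_tsupport h1]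
  have e1 : ∀ x, odot μ h g x * f x = ∫ s, h s * k (s, x) ∂μ := fun x => by
    have h1 := integral_comp_mul_right μ (fun t => h t * g (t * x⁻¹)) x
    simp only [mul_inv_cancel_right, Complex.real_smul] at h1
    rw [odot, h1, mul_right_comm, mul_comm _ (∫ t, _ ∂μ), ← integral_mul_const]
    congr with s
    simp only [k]
    ring
  simp only [e1]
  rw [hh.integral_integral_swap hk h'k]
  simp only [k, conv_eq_integral hf hg h'f]

theorem continuous_conv (hf : Continuous f) (hg : Continuous g) (h'g : HasCompactSupport g) :
    Continuous (conv μ g f) := by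
  have hK : IsCompact (tsupport g) := h'g
  rw [← continuousOn_univ]
  refine continuousOn_integral_of_compact_support hK ?_ fun x t _ ht => ?_
  · exact Continuous.continuousOn (by fun_prop)
  · simp [image_eq_zero_of_notMem_tsupport ht]

theorem hasCompactSupport_conv (h'f : HasCompactSupport f) (h'g : HasCompactSupport g) :
    HasCompactSupport (conv μ g f) := by
  have hKf : IsCompact (tsupport f) := h'f
  have hKg : IsCompact (tsupport g) := h'g
  refine HasCompactSupport.intro (hKg.mul hKf) fun x hx => ?_
  refine integral_eq_zero_of_ae (ae_of_all _ fun t => ?_)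
  by_cases ht : t ∈ tsupport g
  · have : f (t⁻¹ * x) = 0 := image_eq_zero_of_notMem_tsupport fun h2 =>
      hx ⟨t, ht, _, h2, by simp⟩
    simp [this]
  · simp [image_eq_zero_of_notMem_tsupport ht]

theorem conv_norm (x : G) : conv μ (fun t => (‖g t‖ : ℂ)) (fun t => (‖f t‖ : ℂ)) x
    = ((∫ t, ‖g t * f (t⁻¹ * x)‖ ∂μ : ℝ) : ℂ) := by
  simp only [conv, norm_mul, ← Complex.ofReal_mul]
  exact integral_ofReal

theorem norm_conv_norm (x : G) : ‖conv μ (fun t => (‖g t‖ : ℂ)) (fun t => (‖f t‖ : ℂ)) x‖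
    = ∫ t, ‖g t * f (t⁻¹ * x)‖ ∂μ := by
  rw [conv_norm, Complex.norm_real, Real.norm_of_nonneg (integral_nonneg fun _ => norm_nonneg _)]

/-- Submultiplicativity of the norm of `L₁(G, w)`. -/
theorem integral_weight_conv_norm_le (w : Weight G) (hg : Continuous g)
    (h'g : HasCompactSupport g) (hf : Continuous f) (h'f : HasCompactSupport f) :
    ∫ x, w x * ‖conv μ (fun t => (‖g t‖ : ℂ)) (fun t => (‖f t‖ : ℂ)) x‖ ∂μ
      ≤ (∫ x, w x * ‖g x‖ ∂μ) * ∫ x, w x * ‖f x‖ ∂μ := by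
  have hg1 : Continuous fun t => (‖g t‖ : ℂ) := by fun_prop
  have h'g1 : HasCompactSupport fun t => (‖g t‖ : ℂ) :=
    h'g.comp_left (g := fun z : ℂ => (‖z‖ : ℂ)) (by simp)
  have hf1 : Continuous fun t => (‖f t‖ : ℂ) := by fun_prop
  have h'f1 : HasCompactSupport fun t => (‖f t‖ : ℂ) :=
    h'f.comp_left (g := fun z : ℂ => (‖z‖ : ℂ)) (by simp)
  -- The weight itself has norm one in `L_∞(G, w⁻¹)`. Pairing it with `|g| * |f|` gives the norm of
  -- the convolution, and the bound for `w ⊙ |g|` finishes.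
  have hw : LinfBound μ w 1 fun x => (w x : ℂ) :=
    linfBound_of_continuous (Complex.continuous_ofReal.comp w.continuous) fun x => by
      rw [w.norm_ofReal, one_mul]
  have h1 := integral_mul_conv_of_continuous hw hg1 h'g1 hf1 h'f1
  have h2 : ∫ x, (w x : ℂ) * conv μ (fun t => (‖g t‖ : ℂ)) (fun t => (‖f t‖ : ℂ)) x ∂μ
      = ((∫ x, w x * ‖conv μ (fun t => (‖g t‖ : ℂ)) (fun t => (‖f t‖ : ℂ)) x‖ ∂μ : ℝ) : ℂ) := by
    rw [← integral_complex_ofReal]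
    congr with x
    rw [norm_conv_norm, conv_norm]
    push_cast
    rfl
  have h3 := (linfBound_odot zero_le_one hw (memL1_of_continuous μ w hg1 h'g1)).norm_integral_mul_le
    (memL1_of_continuous μ w hf1 h'f1)
  rw [← h1, h2, Complex.norm_real, one_mul, Real.norm_of_nonneg integral_weight_norm_nonneg] at h3
  simpa only [Complex.norm_real, norm_norm] using h3

/-- The map `t ↦ t⁻¹ x` involves inversion, which sends null sets only to locally null ones; hence
the restriction to `K`. -/
theorem ae_restrict_inv_mul {P : G → Prop} (hP : ∀ᵐ s ∂μ, P s) (x : G) {K : Set G}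
    (hK : IsCompact K) : ∀ᵐ t ∂μ.restrict K, P (t⁻¹ * x) := by
  rw [ae_restrict_iff' hK.measurableSet, ae_iff]
  have h1 := measure_inter_inv_eq_zero μ (ae_iff.mp hP) (hK.image (continuous_const_mul x⁻¹))
  rw [← measure_preimage_mul μ x⁻¹] at h1
  refine measure_mono_null (fun t ht => ?_) h1
  simp only [Classical.not_imp, Set.mem_ofPred_eq] at ht
  exact ⟨⟨t, ht.1, rfl⟩, by simpa using ht.2⟩

end Convolution

/-! ### The identity `⟨h ⊙ g, f⟩ = ⟨h, g * f⟩` for arbitrary `g` and `f`. -/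

section Odot
variable {G : Type u} [Group G] [TopologicalSpace G] [IsTopologicalGroup G] [T2Space G]
  [LocallyCompactSpace G] [MeasurableSpace G] [BorelSpace G]
  {μ : Measure G} [μ.IsHaarMeasure] [μ.Regular] {w : Weight G} {C : ℝ} {f g h : G → ℂ}

theorem hasSum_mul_of_summable_norm {ι κ : Type*} {a : ι → ℂ} {b : κ → ℂ} {s t : ℂ}
    (ha : Summable fun i => ‖a i‖) (hs : HasSum a s) (hb : Summable fun i => ‖b i‖)
    (ht : HasSum b t) : HasSum (fun p : ι × κ => a p.1 * b p.2) (s * t) :=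
  hs.mul ht (summable_mul_of_summable_norm ha hb)

/-- The expansion of `f(t⁻¹ x)` is available for almost every `t` only on compact sets. The supports
of the `γ n` suffice, because off their union all terms, and almost everywhere also `g`, vanish. -/
theorem conv_hasSum {γ φ : ℕ → G → ℂ} (hγ : ∀ n, Continuous (γ n))
    (h'γ : ∀ n, HasCompactSupport (γ n)) (hφ : ∀ n, Continuous (φ n))
    (hg : ∀ᵐ t ∂μ, (Summable fun n => ‖γ n t‖) ∧ HasSum (fun n => γ n t) (g t))
    (hf : ∀ᵐ t ∂μ, (Summable fun n => ‖φ n t‖) ∧ HasSum (fun n => φ n t) (f t)) (x : G)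
    (hx : Summable fun p : ℕ × ℕ => ∫ t, ‖γ p.1 t * φ p.2 (t⁻¹ * x)‖ ∂μ) :
    HasSum (fun p : ℕ × ℕ => conv μ (γ p.1) (φ p.2) x) (conv μ g f x) := by
  have hi : ∀ p : ℕ × ℕ, Integrable (fun t => γ p.1 t * φ p.2 (t⁻¹ * x)) μ := fun p =>
    Continuous.integrable_of_hasCompactSupport
      ((hγ p.1).mul ((hφ p.2).comp (by fun_prop))) (h'γ p.1).mul_right
  have h1 := hasSum_integral_of_summable_integral_norm hi hx
  have h2 : ∀ᵐ t ∂μ, ∑' p : ℕ × ℕ, γ p.1 t * φ p.2 (t⁻¹ * x) = g t * f (t⁻¹ * x) := by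
    have h3 : ∀ᵐ t ∂μ, ∀ n, t ∈ tsupport (γ n) →
        (Summable fun n => ‖φ n (t⁻¹ * x)‖) ∧
          HasSum (fun n => φ n (t⁻¹ * x)) (f (t⁻¹ * x)) := by
      refine ae_all_iff.mpr fun n => ?_
      have hK : IsCompact (tsupport (γ n)) := h'γ n
      rw [← ae_restrict_iff' hK.measurableSet]
      exact ae_restrict_inv_mul hf x hK
    filter_upwards [hg, h3] with t ht h4
    by_cases h5 : ∃ n, t ∈ tsupport (γ n)
    · obtain ⟨n, hn⟩ := h5
      exact (hasSum_mul_of_summable_norm ht.1 ht.2 (h4 n hn).1 (h4 n hn).2).tsum_eq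
    · have h6 : ∀ n, γ n t = 0 := fun n =>
        image_eq_zero_of_notMem_tsupport fun h7 => h5 ⟨n, h7⟩
      have h7 : g t = 0 := ht.2.unique (by simp only [h6]; exact hasSum_zero)
      simp [h6, h7]
  rwa [integral_congr_ae h2] at h1

theorem odot_hasSum (hC : 0 ≤ C) (hh : LinfBound μ w C h) {γ : ℕ → G → ℂ}
    (hγ : ∀ n, MemL1 μ w (γ n)) (hs : Summable fun n => ∫ x, w x * ‖γ n x‖ ∂μ)
    (hg : ∀ᵐ t ∂μ, HasSum (fun n => γ n t) (g t)) (x : G) :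
    (Summable fun n => ‖odot μ h (γ n) x‖) ∧ HasSum (fun n => odot μ h (γ n) x) (odot μ h g x) := by
  have hx := hh.comp_mul_right hC x
  constructor
  · exact Summable.of_nonneg_of_le (fun n => norm_nonneg _) (fun n => norm_odot_le hC hh (hγ n) x)
      ((hs.mul_left C).mul_right (w x))
  · have h1 := hasSum_integral_of_summable_integral_norm (fun n => hx.integrable_mul (hγ n))
      (Summable.of_nonneg_of_le (fun n => integral_nonneg fun _ => norm_nonneg _)
        (fun n => hx.integral_norm_mul_le (hγ n)) (hs.mul_left _))
    have h2 : ∀ᵐ t ∂μ, ∑' n, h (t * x) * γ n t = h (t * x) * g t := by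
      filter_upwards [hg] with t ht
      exact (ht.mul_left _).tsum_eq
    rwa [integral_congr_ae h2] at h1

/-- The function `odot μ h g` represents `h ⊙ g`. -/
theorem isOdot_odot (hC : 0 ≤ C) (hh : LinfBound μ w C h) (hg : MemL1 μ w g) :
    IsOdot μ w (odot μ h g) h g := by
  intro f hf
  obtain ⟨γ, hγ, h'γ, hγs, hγg⟩ := hg.exists_hasSum
  obtain ⟨φ, hφ, h'φ, hφs, hφf⟩ := hf.exists_hasSum
  have mγ : ∀ n, MemL1 μ w (γ n) := fun n => memL1_of_continuous μ w (hγ n) (h'γ n)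
  have mφ : ∀ n, MemL1 μ w (φ n) := fun n => memL1_of_continuous μ w (hφ n) (h'φ n)
  have hprod : Summable fun p : ℕ × ℕ => (∫ x, w x * ‖γ p.1 x‖ ∂μ) * ∫ x, w x * ‖φ p.2 x‖ ∂μ :=
    hγs.mul_of_nonneg hφs (fun _ => integral_weight_norm_nonneg)
      fun _ => integral_weight_norm_nonneg
  have hcm : ∀ {a b : G → ℂ}, Continuous a → HasCompactSupport a → Continuous b →
      HasCompactSupport b → MemL1 μ w (conv μ a b) := fun ha h'a hb h'b =>
    memL1_of_continuous μ w (continuous_conv hb ha h'a) (hasCompactSupport_conv h'b h'a)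
  -- The convolutions `|γ_m| * |φ_n|` dominate the terms. Their summability in `L₁(G, w)` yields,
  -- for almost every `x`, the absolute summability required by `conv_hasSum`.
  let B : ℕ × ℕ → G → ℂ := fun p =>
    conv μ (fun t => (‖γ p.1 t‖ : ℂ)) (fun t => (‖φ p.2 t‖ : ℂ))
  have mB : ∀ p, MemL1 μ w (B p) := fun p =>
    hcm (by have := hγ p.1; fun_prop)
      ((h'γ p.1).comp_left (g := fun z : ℂ => (‖z‖ : ℂ)) (by simp))
      (by have := hφ p.2; fun_prop)
      ((h'φ p.2).comp_left (g := fun z : ℂ => (‖z‖ : ℂ)) (by simp))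
  have hB : Summable fun p => ∫ x, w x * ‖B p x‖ ∂μ :=
    Summable.of_nonneg_of_le (fun _ => integral_weight_norm_nonneg) (fun p =>
      integral_weight_conv_norm_le w (hγ p.1) (h'γ p.1) (hφ p.2) (h'φ p.2)) hprod
  have mconv : ∀ p : ℕ × ℕ, MemL1 μ w (conv μ (γ p.1) (φ p.2)) := fun p =>
    hcm (hγ p.1) (h'γ p.1) (hφ p.2) (h'φ p.2)
  have hconv : Summable fun p : ℕ × ℕ => ∫ x, w x * ‖conv μ (γ p.1) (φ p.2) x‖ ∂μ := by
    refine Summable.of_nonneg_of_le (fun _ => integral_weight_norm_nonneg) (fun p => ?_) hB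
    refine integral_mono (mconv p).integrable_norm (mB p).integrable_norm fun x => ?_
    refine mul_le_mul_of_nonneg_left ?_ (w.pos' x).le
    simp only [B, norm_conv_norm]
    exact norm_integral_le_integral_norm _
  have left : HasSum (fun p : ℕ × ℕ => ∫ x, h x * conv μ (γ p.1) (φ p.2) x ∂μ)
      (∫ x, h x * conv μ g f x ∂μ) := by
    have h1 := hasSum_integral_of_summable_integral_norm (fun p => hh.integrable_mul (mconv p))
      (Summable.of_nonneg_of_le (fun p => integral_nonneg fun _ => norm_nonneg _)
        (fun p => hh.integral_norm_mul_le (mconv p)) (hconv.mul_left C))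
    have h2 : ∀ᵐ x ∂μ, ∑' p : ℕ × ℕ, h x * conv μ (γ p.1) (φ p.2) x = h x * conv μ g f x := by
      filter_upwards [ae_summable_norm mB hB] with x hx
      simp only [B, norm_conv_norm] at hx
      exact ((conv_hasSum hγ h'γ hφ hγg hφf x hx).mul_left _).tsum_eq
    rwa [integral_congr_ae h2] at h1
  have right : HasSum (fun p : ℕ × ℕ => ∫ x, odot μ h (γ p.1) x * φ p.2 x ∂μ)
      (∫ x, odot μ h g x * f x ∂μ) := by
    have hb : ∀ p : ℕ × ℕ, LinfBound μ w (C * ∫ t, w t * ‖γ p.1 t‖ ∂μ) (odot μ h (γ p.1)) :=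
      fun p => linfBound_odot hC hh (mγ p.1)
    have h1 := hasSum_integral_of_summable_integral_norm
      (fun p : ℕ × ℕ => (hb p).integrable_mul (mφ p.2))
      (Summable.of_nonneg_of_le (fun p => integral_nonneg fun _ => norm_nonneg _)
        (fun p => ((hb p).integral_norm_mul_le (mφ p.2)).trans (mul_assoc _ _ _).le)
        (hprod.mul_left C))
    have h2 : ∀ᵐ x ∂μ, ∑' p : ℕ × ℕ, odot μ h (γ p.1) x * φ p.2 x = odot μ h g x * f x := by
      filter_upwards [hφf] with x hx
      have h3 := odot_hasSum hC hh mγ hγs (hγg.mono fun _ ht => ht.2) x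
      exact (hasSum_mul_of_summable_norm h3.1 h3.2 hx.1 hx.2).tsum_eq
    rwa [integral_congr_ae h2] at h1
  refine right.unique ?_
  simp only [integral_mul_conv_of_continuous hh (hγ _) (h'γ _) (hφ _) (h'φ _)] at left
  exact left

end Odot

/-! ### Separated translates inside a dispersed set. -/

section Dispersed
variable {G : Type u} [Group G] [TopologicalSpace G] [IsTopologicalGroup G]

theorem exists_cover_mk_eq (G : Type u) [TopologicalSpace G] :
    ∃ 𝒦 : Set (Set G), (∀ K ∈ 𝒦, IsCompact K) ∧ ⋃₀ 𝒦 = Set.univ ∧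
      Cardinal.mk 𝒦 = compactCoveringNumber G :=
  csInf_mem (s := {c | ∃ 𝒦 : Set (Set G), (∀ K ∈ 𝒦, IsCompact K) ∧ ⋃₀ 𝒦 = Set.univ ∧
    Cardinal.mk 𝒦 = c}) ⟨_, {K | IsCompact K}, fun _ hK => hK,
      Set.eq_univ_of_forall fun x => ⟨{x}, isCompact_singleton, rfl⟩, rfl⟩

/-- Inside a dispersed set, every family of at most `κ(G)` compact sets can be translated to
pairwise separated position. -/
theorem IsDispersed.exists_disjoint {S : Set G} (hS : IsDispersed S) {P : Type u}
    (hP : Cardinal.mk P = compactCoveringNumber G) {E : P → Set G} (hE : ∀ p, IsCompact (E p))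
    {U : Set G} (hU : IsCompact U) (hUi : ∀ u ∈ U, u⁻¹ ∈ U) :
    ∃ y : P → G, (∀ p, y p ∈ S) ∧
      ∀ p q, p ≠ q → Disjoint (U * (E p * {y p})) (E q * {y q}) := by
  -- With `P` ordered in the type of its initial ordinal, every point has fewer than `κ(G)`
  -- predecessors.
  obtain ⟨r, hwo, hr⟩ := Cardinal.exists_ord_eq P
  have hlt : ∀ p : P, Cardinal.mk {q // r q p} < compactCoveringNumber G := fun p => by
    rw [← hP]
    have := Ordinal.typein_lt_type r p
    rw [← hr, Cardinal.lt_ord, Ordinal.card_typein] at this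
    exact this
  -- The earlier choices forbid fewer than `κ(G)` compact sets, and these cannot cover `S`.
  have step : ∀ (p : P) (y : ∀ q, r q p → G), ∃ z ∈ S, ∀ q (hq : r q p),
      z ∉ (E p)⁻¹ * (U * (E q * {y q hq})) := by
    intro p y
    have h1 := hS (Set.range fun q : {q // r q p} => (E p)⁻¹ * (U * (E q.1 * {y q.1 q.2}))) ?_
      (Cardinal.mk_range_le.trans_lt (hlt p))
    · obtain ⟨z, hz, hz'⟩ := Set.not_subset.mp h1
      exact ⟨z, hz, fun q hq hzq => hz' ⟨_, ⟨⟨q, hq⟩, rfl⟩, hzq⟩⟩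
    · rintro _ ⟨q, rfl⟩
      exact (hE p).inv.mul (hU.mul ((hE q.1).mul isCompact_singleton))
  choose z hzS hz using step
  have wf : WellFounded r := hwo.wf
  let y : P → G := wf.fix z
  have hy : ∀ p, y p = z p fun q _ => y q := fun p => wf.fix_eq z p
  have key : ∀ p q, r q p → y p ∉ (E p)⁻¹ * (U * (E q * {y q})) := fun p q hq => by
    rw [hy p]
    exact hz p (fun q _ => y q) q hq
  refine ⟨y, fun p => by rw [hy p]; exact hzS _ _, fun p q hpq => ?_⟩
  rw [Set.disjoint_left]
  rintro x ⟨u, hu, _, ⟨a, ha, _, rfl, rfl⟩, rfl⟩ ⟨b, hb, _, rfl, hab⟩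
  simp only at hab
  -- From `u a y_p = b y_q` the later of the two points can be solved for; when it is `y_p`, this
  -- uses `u⁻¹ ∈ U`.
  rcases trichotomous_of r p q with h | h | h
  · exact key q p h ⟨b⁻¹, by simpa using hb, _, ⟨u, hu, _, ⟨a, ha, _, rfl, rfl⟩, rfl⟩, by
      simp only [← hab]; group⟩
  · exact hpq h
  · exact key p q h ⟨a⁻¹, by simpa using ha, _,
      ⟨u⁻¹, hUi u hu, _, ⟨b, hb, _, rfl, rfl⟩, rfl⟩, by simp only [hab]; group⟩

/-- If `W W⁻¹ ⊆ U`, then `W x` meets at most one set: from `a ∈ A p` and `b ∈ A q` in `W x` follows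
`b a⁻¹ ∈ U`, so `b ∈ U A p`. -/
theorem locallyFinite_of_disjoint_mul {P : Type*} {A : P → Set G} {U : Set G} (hU : U ∈ 𝓝 1)
    (h : ∀ p q, p ≠ q → Disjoint (U * A p) (A q)) : LocallyFinite A := by
  obtain ⟨W, hW, hWU⟩ := exists_nhds_split_inv hU
  intro x
  refine ⟨(· * x⁻¹) ⁻¹' W, (continuous_mul_const x⁻¹).continuousAt.preimage_mem_nhds (by simpa), ?_⟩
  refine Set.Subsingleton.finite fun p hp q hq => ?_
  obtain ⟨a, ha, ha'⟩ := hp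
  obtain ⟨b, hb, hb'⟩ := hq
  by_contra hpq
  refine Set.disjoint_left.mp (h p q hpq) ⟨_, hWU _ hb' _ ha', a, ha, ?_⟩ hb
  simp only [div_eq_mul_inv]
  group

variable [LocallyCompactSpace G]

theorem exists_symmetric_compact_nhds_one [T2Space G] :
    ∃ U : Set G, IsCompact U ∧ U ∈ 𝓝 1 ∧ ∀ u ∈ U, u⁻¹ ∈ U := by
  obtain ⟨V, hV, hV1⟩ := exists_compact_mem_nhds (1 : G)
  refine ⟨V ∩ V⁻¹, hV.inter_right hV.inv.isClosed, inter_mem hV1 ?_, fun u hu => ?_⟩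
  · exact continuous_inv.continuousAt.preimage_mem_nhds (by simpa using hV1)
  · exact ⟨hu.2, by simpa using hu.1⟩

/-- A cover by compact sets gives a directed family of compact sets in which every compact set
is eventually contained. -/
theorem exists_directed_compacts {𝒦 : Set (Set G)} (h𝒦 : ∀ K ∈ 𝒦, IsCompact K)
    (hc : ⋃₀ 𝒦 = Set.univ) :
    ∃ E : Finset 𝒦 → Set G, (∀ F, IsCompact (E F)) ∧
      ∀ L, IsCompact L → ∀ᶠ F in atTop, L ⊆ E F := by
  classical
  obtain ⟨V, hV, hV1⟩ := exists_compact_mem_nhds (1 : G)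
  -- The members of the cover may have empty interior. Thickening finite unions by `V` makes them
  -- absorb every compact set, as finitely many translates `V x` cover it.
  refine ⟨fun F => V * ⋃ j ∈ F, (j : Set G),
    fun F => hV.mul (F.isCompact_biUnion fun j _ => h𝒦 _ j.2), fun L hL => ?_⟩
  have hx : ∀ x : G, ∃ j : 𝒦, x ∈ (j : Set G) := fun x => by
    obtain ⟨K, hK, hxK⟩ := hc.symm ▸ Set.mem_univ x
    exact ⟨⟨K, hK⟩, hxK⟩
  choose j hj using hx
  obtain ⟨t, -, ht⟩ := hL.elim_nhds_subcover (fun x => (· * x⁻¹) ⁻¹' V) fun x _ =>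
    (continuous_mul_const x⁻¹).continuousAt.preimage_mem_nhds (by simpa)
  filter_upwards [eventually_ge_atTop (t.image j)] with F hF x hxL
  obtain ⟨a, ha, hxa⟩ := Set.mem_iUnion₂.mp (ht hxL)
  exact ⟨x * a⁻¹, hxa, a, Set.mem_biUnion (hF (Finset.mem_image_of_mem j ha)) (hj a), by simp⟩

end Dispersed

/-! ### Gluing along separated sets and limits of point masses. -/

section Glue
variable {G : Type u} [Group G] [TopologicalSpace G] [IsTopologicalGroup G] [T2Space G]
  [LocallyCompactSpace G] [MeasurableSpace G] [BorelSpace G]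
  {μ : Measure G} [μ.IsHaarMeasure] [μ.Regular] {w : Weight G} {C D : ℝ} {g h k : G → ℂ}

theorem LinfBound.const_mul (hh : LinfBound μ w C h) (c : ℂ) :
    LinfBound μ w (‖c‖ * C) (fun x => c * h x) :=
  linfBound_of_ae_norm_le (fun K hK => (hh K hK).1.const_mul c) fun K hK => by
    filter_upwards [hh.ae_norm_le hK] with x hx
    rw [norm_mul, mul_assoc]
    exact mul_le_mul_of_nonneg_left hx (norm_nonneg _)

theorem LinfBound.sub (hh : LinfBound μ w C h) (hk : LinfBound μ w D k) :
    LinfBound μ w (C + D) (fun x => h x - k x) :=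
  linfBound_of_ae_norm_le (fun K hK => (hh K hK).1.sub (hk K hK).1) fun K hK => by
    filter_upwards [hh.ae_norm_le hK, hk.ae_norm_le hK] with x h1 h2
    rw [add_mul]
    exact (norm_sub_le _ _).trans (add_le_add h1 h2)

/-- A compact set meets only finitely many `A p`, so measurability and the bound on it are inherited
from finitely many `H p`, although the index set may be uncountable. -/
theorem linfBound_of_locallyFinite (hD : 0 ≤ D) {P : Type*} {A : P → Set G}
    (hA : ∀ p, IsCompact (A p)) (lf : LocallyFinite A) {H : P → G → ℂ}
    (hH : ∀ p, LinfBound μ w D (H p)) (h1 : ∀ p, ∀ s ∈ A p, h s = H p s)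
    (h0 : ∀ s, (∀ p, s ∉ A p) → h s = 0) : LinfBound μ w D h := by
  have hfin : ∀ K : Set G, IsCompact K → Finite {p | (A p ∩ K).Nonempty} := fun K hK =>
    (lf.finite_nonempty_inter_compact hK).to_subtype
  refine linfBound_of_ae_norm_le (fun K hK => ?_) (fun K hK => ?_)
  · have := hfin K hK
    let T := ⋃ p : {p | (A p ∩ K).Nonempty}, A p
    have hT : MeasurableSet T := MeasurableSet.iUnion fun p => (hA p).measurableSet
    have m1 : AEStronglyMeasurable h (μ.restrict T) :=
      aestronglyMeasurable_iUnion_iff.mpr fun p => ((hH p _ (hA p)).1).congr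
        (ae_restrict_of_forall_mem (hA p).measurableSet fun s hs => (h1 p s hs).symm)
    have m2 : AEStronglyMeasurable h (μ.restrict (K \ T)) :=
      aestronglyMeasurable_zero.congr
        (ae_restrict_of_forall_mem (hK.measurableSet.diff hT) fun s hs =>
          (h0 s fun p hp => hs.2 (Set.mem_iUnion.mpr ⟨⟨p, s, hp, hs.1⟩, hp⟩)).symm)
    refine (aestronglyMeasurable_union_iff.mpr ⟨m1, m2⟩).mono_set fun x hx => ?_
    by_cases hxT : x ∈ T
    exacts [Or.inl hxT, Or.inr ⟨hx, hxT⟩]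
  · have := hfin K hK
    have hall : ∀ᵐ x ∂μ.restrict K, ∀ p : {p | (A p ∩ K).Nonempty}, ‖H p x‖ ≤ D * w x :=
      ae_all_iff.mpr fun p => (hH p).ae_norm_le hK
    filter_upwards [hall, ae_restrict_mem hK.measurableSet] with x hx hxK
    by_cases hxA : ∃ p, x ∈ A p
    · obtain ⟨p, hp⟩ := hxA
      rw [h1 p x hp]
      exact hx ⟨p, x, hp, hxK⟩
    · rw [h0 x fun p hp => hxA ⟨p, hp⟩, norm_zero]
      exact mul_nonneg hD (w.pos' x).le

theorem LinfBound.norm_integral_mul_le_of_eqOn_zero (hk : LinfBound μ w C k) (hg : MemL1 μ w g)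
    {K : Set G} (hK : IsCompact K) (h0 : ∀ t ∈ K, k t = 0) :
    ‖∫ t, k t * g t ∂μ‖ ≤ C * ∫ t in Kᶜ, w t * ‖g t‖ ∂μ := by
  have hm := hK.measurableSet.compl
  have h1 : MemL1 μ w (Kᶜ.indicator g) := by
    refine (Integrable.indicator hg hm).congr (ae_of_all _ fun t => ?_)
    by_cases ht : t ∈ Kᶜ <;> simp [ht]
  have h2 := hk.norm_integral_mul_le h1
  have h3 : (fun t => k t * Kᶜ.indicator g t) = fun t => k t * g t := by
    ext t
    by_cases ht : t ∈ K
    · simp [h0 t ht]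
    · simp [ht]
  have h4 : (fun t => w t * ‖Kᶜ.indicator g t‖) = Kᶜ.indicator fun t => w t * ‖g t‖ := by
    ext t
    by_cases ht : t ∈ K <;> simp [ht]
  rwa [h3, h4, integral_indicator hm] at h2

theorem norm_pointMass_le (w : Weight G) (y : G) :
    ‖WeakDual.toStrongDual (pointMass w y)‖ ≤ 1 :=
  ContinuousLinearMap.opNorm_le_bound _ zero_le_one fun f => by
    rw [one_mul]
    exact (LUCw.divWeight w f).norm_coe_le_norm y

/-- Along points `y` such that `h₀ (t y) = w y * k t` on larger and larger compact sets, the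
normalized point masses converge on `h₀ ⊙ g` to `⟨k, g⟩`. -/
theorem tendsto_pointMass_odotLUC {ι : Type*} {l : Filter ι} {h₀ : G → ℂ} (hD : 0 ≤ D)
    (hh₀ : LinfBound μ w D h₀) (hk : LinfBound μ w C k) (hg : MemL1 μ w g) {y : ι → G}
    (hy : ∀ L, IsCompact L → ∀ᶠ i in l, ∀ t ∈ L, h₀ (t * y i) = w (y i) * k t) :
    Tendsto (fun i => pointMass w (y i) (odotLUC hD hh₀ hg)) l (𝓝 (pairing μ k g)) := by
  rw [Metric.tendsto_nhds]
  intro ε hε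
  obtain ⟨K, hK, hKε⟩ := hg.exists_compact_tail (ε := ε / (2 * (|D + C| + 1))) (by positivity)
  filter_upwards [hy K hK] with i hi
  have hw := w.pos' (y i)
  -- The factor `w (y i)` gained by translating `h₀` cancels against the normalization, so the bound
  -- does not depend on `i`.
  have hb : LinfBound μ w (D + C) (fun t => ((w (y i) : ℂ)⁻¹ * h₀ (t * y i)) - k t) := by
    have h1 := ((hh₀.comp_mul_right hD (y i)).const_mul (w (y i) : ℂ)⁻¹).sub hk
    rw [norm_inv, w.norm_ofReal, mul_comm D, inv_mul_cancel_left₀ hw.ne'] at h1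
    exact h1
  have e : pointMass w (y i) (odotLUC hD hh₀ hg) - pairing μ k g
      = ∫ t, ((w (y i) : ℂ)⁻¹ * h₀ (t * y i) - k t) * g t ∂μ := by
    rw [pointMass_apply, odotLUC_val, odot, pairing, ← integral_const_mul, ← integral_sub
      (((hh₀.comp_mul_right hD (y i)).integrable_mul hg).const_mul _) (hk.integrable_mul hg)]
    congr with t
    ring
  rw [dist_eq_norm, e]
  calc _ ≤ (D + C) * ∫ t in Kᶜ, w t * ‖g t‖ ∂μ :=
        hb.norm_integral_mul_le_of_eqOn_zero hg hK fun t ht => by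
          rw [hi t ht, inv_mul_cancel_left₀ (w.ofReal_ne_zero _), sub_self]
    _ ≤ (|D + C| + 1) * (ε / (2 * (|D + C| + 1))) :=
        mul_le_mul (by linarith [le_abs_self (D + C)]) hKε
          (integral_nonneg fun t => mul_nonneg (w.pos' t).le (norm_nonneg _)) (by positivity)
    _ = ε / 2 := by field_simp
    _ < ε := half_lt_self hε

end Glue

end WeightedGroup

/-! ### Construction of the functionals and of the common function. -/

open Pointwise in
theorem theorem2p2 {G : Type u} [Group G] [TopologicalSpace G] [IsTopologicalGroup G]
    [T2Space G] [LocallyCompactSpace G] [NoncompactSpace G] [MeasurableSpace G] [BorelSpace G]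
    (μ : MeasureTheory.Measure G) [μ.IsHaarMeasure] [μ.Regular]
    (w : WeightedGroup.Weight G) (S : Set G) (hS : WeightedGroup.IsDispersed S)
    (hwS : w.DiagonallyBoundedOn S) :
    ∃ (I : Type u) (ψ : I → WeakDual ℂ (WeightedGroup.LUCw w)),
      Cardinal.mk I = WeightedGroup.compactCoveringNumber G ∧
      (∀ α, ψ α ∈ closure (Set.range (WeightedGroup.pointMass w))) ∧
      (∀ α, ‖WeakDual.toStrongDual (ψ α)‖ ≤ 1) ∧
      ∀ h : I → G → ℂ, WeightedGroup.BoundedFamily μ w h →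
        ∃ h₀ : G → ℂ, WeightedGroup.MemLinf μ w h₀ ∧
          ∀ α, WeightedGroup.IsDiamond μ w (h α) (ψ α) h₀ := by
  classical
  obtain ⟨𝒦, h𝒦, hcov, hcard⟩ := WeightedGroup.exists_cover_mk_eq G
  have hinf : Infinite 𝒦 := by
    rw [Set.infinite_coe_iff]
    intro hfin
    exact noncompact_univ G (hcov ▸ hfin.isCompact_sUnion h𝒦)
  obtain ⟨E, hE, hEev⟩ := WeightedGroup.exists_directed_compacts h𝒦 hcov
  obtain ⟨U, hU, hU1, hUi⟩ := WeightedGroup.exists_symmetric_compact_nhds_one (G := G)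
  -- In a pair, the finite set selects the compact set `E F` and the second entry the index `α`; `𝒦`
  -- itself serves as `I`.
  have hP : Cardinal.mk (Finset 𝒦 × 𝒦) = WeightedGroup.compactCoveringNumber G := by
    rw [Cardinal.mk_prod, Cardinal.lift_id, Cardinal.lift_id, Cardinal.mk_finset_of_infinite,
      Cardinal.mul_eq_self (Cardinal.aleph0_le_mk _), hcard]
  obtain ⟨y, hyS, hy⟩ := hS.exists_disjoint hP (E := fun p => E p.1) (fun p => hE p.1) hU hUi
  have lf := WeightedGroup.locallyFinite_of_disjoint_mul hU1 hy
  -- By Banach–Alaoglu, the point masses converge weak* along an ultrafilter finer than `atTop`.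
  let 𝓤 : Ultrafilter (Finset 𝒦) := Ultrafilter.of atTop
  have hψ : ∀ α : 𝒦, ∃ ψ : WeakDual ℂ (WeightedGroup.LUCw w),
      ‖WeakDual.toStrongDual ψ‖ ≤ 1 ∧
        Tendsto (fun F => WeightedGroup.pointMass w (y (F, α))) 𝓤 (𝓝 ψ) := by
    intro α
    obtain ⟨ψ, hψ, hlim⟩ := (WeakDual.isCompact_closedBall
      (0 : StrongDual ℂ (WeightedGroup.LUCw w)) 1).ultrafilter_le_nhds
      (𝓤.map fun F => WeightedGroup.pointMass w (y (F, α)))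
      (le_principal_iff.mpr (mem_map.mpr <| univ_mem' fun F => by
        simpa using WeightedGroup.norm_pointMass_le w (y (F, α))))
    exact ⟨ψ, by simpa using hψ, hlim⟩
  choose ψ hψn hψlim using hψ
  refine ⟨𝒦, ψ, hcard, fun α => mem_closure_of_tendsto (hψlim α)
    (Eventually.of_forall fun F => ⟨_, rfl⟩), hψn, fun h hh => ?_⟩
  obtain ⟨C₀, hC₀⟩ := hh
  obtain ⟨M₀, hM₀⟩ := hwS
  obtain ⟨C, hC, hhC⟩ : ∃ C : ℝ, 0 ≤ C ∧ ∀ α, WeightedGroup.LinfBound μ w C (h α) :=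
    ⟨max C₀ 0, le_max_right _ _, fun α => (hC₀ α).mono (le_max_left _ _)⟩
  obtain ⟨M, hM, hyM⟩ : ∃ M : ℝ, 0 ≤ M ∧ ∀ p, w (y p) * w (y p)⁻¹ ≤ M :=
    ⟨max M₀ 0, le_max_right _ _, fun p => (hM₀ ⟨_, hyS p, rfl⟩).trans (le_max_left _ _)⟩
  have hD : 0 ≤ C * M := mul_nonneg hC hM
  let A : Finset 𝒦 × 𝒦 → Set G := fun p => E p.1 * {y p}
  let H : Finset 𝒦 × 𝒦 → G → ℂ := fun p s => (w (y p) : ℂ) * h p.2 (s * (y p)⁻¹)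
  -- Translation by `(y p)⁻¹` costs `w (y p)⁻¹`, and the prefactor `w (y p)` makes the product at
  -- most `M`, because `y p ∈ S`.
  have hH : ∀ p, WeightedGroup.LinfBound μ w (C * M) (H p) := fun p => by
    refine (((hhC p.2).comp_mul_right hC (y p)⁻¹).const_mul (w (y p) : ℂ)).mono ?_
    rw [w.norm_ofReal, mul_left_comm]
    exact mul_le_mul_of_nonneg_left (hyM p) hC
  let h₀ : G → ℂ := fun s => if hs : ∃ p, s ∈ A p then H hs.choose s else 0
  have h₀A : ∀ p, ∀ s ∈ A p, h₀ s = H p s := by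
    intro p s hs
    have hex : ∃ p, s ∈ A p := ⟨p, hs⟩
    -- Since `1 ∈ U`, separated sets are disjoint, so the chosen index is the only one.
    have : hex.choose = p := by
      by_contra hne
      exact Set.disjoint_left.mp (hy _ _ hne)
        ⟨1, mem_of_mem_nhds hU1, s, hex.choose_spec, one_mul s⟩ hs
    simp only [h₀, dif_pos hex, this]
  have hh₀ : WeightedGroup.LinfBound μ w (C * M) h₀ :=
    WeightedGroup.linfBound_of_locallyFinite hD (fun p => (hE p.1).mul isCompact_singleton) lf hH
      h₀A fun s hs => dif_neg fun ⟨p, hp⟩ => hs p hp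
  refine ⟨h₀, ⟨_, hh₀⟩, fun α g hg => ⟨WeightedGroup.odotLUC hD hh₀ hg,
    WeightedGroup.isOdot_odot hD hh₀ hg, ?_⟩⟩
  have lim1 : Tendsto (fun F => WeightedGroup.pointMass w (y (F, α))
      (WeightedGroup.odotLUC hD hh₀ hg)) 𝓤 (𝓝 (ψ α (WeightedGroup.odotLUC hD hh₀ hg))) :=
    ((WeakDual.eval_continuous _).tendsto _).comp (hψlim α)
  have lim2 := WeightedGroup.tendsto_pointMass_odotLUC hD hh₀ (hhC α) hg (l := atTop)
    (y := fun F => y (F, α)) fun L hL => by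
      filter_upwards [hEev L hL] with F hF t ht
      rw [h₀A (F, α) _ ⟨t, hF ht, _, rfl, rfl⟩]
      simp [H]
  -- The same point masses tend to `ψ α (h₀ ⊙ g)` along `𝓤` and to `⟨h α, g⟩` along the coarser
  -- filter `atTop`.
  exact tendsto_nhds_unique (lim2.mono_left (Ultrafilter.of_le atTop)) lim1
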